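/- Let $\gamma\in\mathbb{R}\setminus\{0\}$ with $|\gamma|\le 1$, and let $H$ be the operator in $L^2(\mathbb{R})$ (complex-valued functions, $\langle f,g\rangle=\int_{\mathbb{R}} f\,\overline{g}\,dx$) with domain $$\mathcal D(H)=\{\psi\in L^2(\mathbb{R}) : \psi \text{ has weak first and second derivatives } \psi',\psi''\in L^2(\mathbb{R}),\ x^2\psi\in L^2(\mathbb{R})\}$$ given by $$H\psi=-\tfrac14\psi''+x^2\psi-\gamma\left(\tfrac12\psi+x\psi'\right).$$ Then $H$ is m-accretive, that is: 1. its numerical range $W(H)=\{\langle H\psi,\psi\rangle : \psi\in\mathcal D(H),\ \|\psi\|=1\}$ is contained in the closed right half-plane $\{z\in\mathbb{C} : \operatorname{Re} z\ge 0\}$; 2. every $\lambda\in\mathbb{C}$ with $\operatorname{Re}\lambda<0$ belongs to the resolvent set of $H$, that is, $H-\lambda:\mathcal D(H)\to L^2(\mathbb{R})$ is bijective with bounded inverse, and $\|(H-\lambda)^{-1}\|\le 1/|\operatorname{Re}\lambda|$. -/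

import Mathlib

open MeasureTheory Filter Set
open scoped ContDiff Topology

namespace Swanson

theorem locInt_intervalIntegrable {h : ℝ → ℝ} (hh : LocallyIntegrable h) (a b : ℝ) :
    IntervalIntegrable h volume a b :=
  intervalIntegrable_iff.mpr
    ((hh.integrableOn_isCompact isCompact_uIcc).mono_set uIoc_subset_uIcc)

theorem primitive_ac {h : ℝ → ℝ} (hh : LocallyIntegrable h) (c R : ℝ) (hR : 0 ≤ R) :
    AbsolutelyContinuousOnInterval (fun x => c + ∫ t in (0:ℝ)..x, h t) (-R) R := by
  have h1 := (locInt_intervalIntegrable hh (-R) R).absolutelyContinuousOnInterval_intervalIntegral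
    (c := 0) (by rw [uIcc_of_le (by linarith)]; constructor <;> linarith)
  have h2 : AbsolutelyContinuousOnInterval (fun _ : ℝ => c) (-R) R :=
    (contDiff_const (n := 1)).contDiffOn.absolutelyContinuousOnInterval
  exact h2.add h1

theorem ibp_primitive {h P : ℝ → ℝ} (hh : LocallyIntegrable h) (hP : ContDiff ℝ 1 P) (c R : ℝ)
    (hR : 0 ≤ R) (ha : P (-R) = 0) (hb : P R = 0) :
    ∫ x in (-R)..R, deriv P x * (c + ∫ t in (0:ℝ)..x, h t) = -∫ x in (-R)..R, P x * h x := by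
  have hPac : AbsolutelyContinuousOnInterval P (-R) R :=
    hP.contDiffOn.absolutelyContinuousOnInterval
  have h1 := hPac.integral_mul_deriv_eq_deriv_mul (primitive_ac hh c R hR)
  rw [ha, hb] at h1
  have h2 : ∫ x in (-R)..R, P x * deriv (fun x => c + ∫ t in (0:ℝ)..x, h t) x
      = ∫ x in (-R)..R, P x * h x := by
    apply intervalIntegral.integral_congr_ae
    filter_upwards [_root_.LocallyIntegrable.ae_hasDerivAt_integral hh] with x hx _
    rw [((hx 0).const_add c).deriv]
  rw [h2] at h1
  linarith

theorem integral_eq_of_support {f : ℝ → ℝ} {R : ℝ} (hR : 0 ≤ R)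
    (hf : ∀ x, R ≤ |x| → f x = 0) : ∫ x, f x = ∫ x in (-R)..R, f x := by
  rw [intervalIntegral.integral_of_le (by linarith), setIntegral_eq_integral_of_forall_compl_eq_zero]
  intro x hx
  apply hf
  by_contra h
  rw [not_le, abs_lt] at h
  exact hx ⟨h.1, h.2.le⟩

theorem exists_support_radius {φ : ℝ → ℝ} (hφ : HasCompactSupport φ) :
    ∃ R : ℝ, 0 ≤ R ∧ ∀ x, R ≤ |x| → φ x = 0 := by
  obtain ⟨R, hR, h⟩ := hφ.exists_pos_le_norm
  exact ⟨R, hR.le, h⟩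

theorem const_of_weakDeriv_zero {f : ℝ → ℝ} (hf : LocallyIntegrable f)
    (h : ∀ φ : ℝ → ℝ, ContDiff ℝ ∞ φ → HasCompactSupport φ → ∫ x, deriv φ x * f x = 0) :
    ∃ c : ℝ, ∀ᵐ x, f x = c := by
  obtain ⟨η, -, hηc, hηs, hηr, hη0⟩ : ∃ η : ℝ → ℝ, True ∧ HasCompactSupport η ∧ ContDiff ℝ ∞ η ∧
      True ∧ ∫ x, η x = 1 := by
    let B : ContDiffBump (0:ℝ) := ⟨1, 2, by norm_num, by norm_num⟩
    exact ⟨B.normed volume, trivial, B.hasCompactSupport_normed, B.contDiff_normed, trivial,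
      B.integral_normed⟩
  refine ⟨∫ x, η x * f x, ?_⟩
  apply ae_eq_of_integral_contDiff_smul_eq hf (locallyIntegrable_const _)
  intro ψ hψs hψc
  obtain ⟨R1, hR1, h1⟩ := exists_support_radius hηc
  obtain ⟨R2, hR2, h2⟩ := exists_support_radius hψc
  set m := ∫ x, ψ x with hm
  let k : ℝ → ℝ := fun x => ψ x - m * η x
  have hks : ContDiff ℝ ∞ k := hψs.sub (contDiff_const.mul hηs)
  set R := max R1 R2
  have hR : 0 ≤ R := le_max_of_le_left hR1
  have hk0 : ∀ x, R ≤ |x| → k x = 0 := fun x hx => by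
    simp [k, h1 x ((le_max_left _ _).trans hx), h2 x ((le_max_right _ _).trans hx)]
  have hψi : Integrable ψ := hψs.continuous.integrable_of_hasCompactSupport hψc
  have hηi : Integrable η := hηs.continuous.integrable_of_hasCompactSupport hηc
  have hkint : ∫ x, k x = 0 := by
    simp only [k]
    rw [integral_sub hψi (hηi.const_mul m), integral_const_mul, hη0]
    simp [hm]
  have hkI : ∫ x in (-R)..R, k x = 0 := by rw [← integral_eq_of_support hR hk0, hkint]
  let φ : ℝ → ℝ := fun x => ∫ t in (-R)..x, k t
  have hφd : ∀ x, HasDerivAt φ (k x) x := fun x =>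
    (hks.continuous.integral_hasStrictDerivAt (-R) x).hasDerivAt
  have hφd' : deriv φ = k := funext fun x => (hφd x).deriv
  have hφs : ContDiff ℝ ∞ φ := by
    rw [contDiff_infty_iff_deriv, hφd']
    exact ⟨fun x => (hφd x).differentiableAt, hks⟩
  have hφ0 : ∀ x, R ≤ |x| → φ x = 0 := by
    intro x hx
    rcases le_abs.mp hx with hx | hx
    · have : φ x = (∫ t in (-R)..R, k t) + ∫ t in R..x, k t :=
        (intervalIntegral.integral_add_adjacent_intervals
          (hks.continuous.intervalIntegrable _ _) (hks.continuous.intervalIntegrable _ _)).symm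
      rw [this, hkI, zero_add]
      apply intervalIntegral.integral_zero_ae
      filter_upwards with t ht
      rw [uIoc_of_le hx] at ht
      exact hk0 t (le_abs.mpr (Or.inl ht.1.le))
    · apply intervalIntegral.integral_zero_ae
      filter_upwards with t ht
      rw [uIoc_of_ge (by linarith)] at ht
      exact hk0 t (le_abs.mpr (Or.inr (by linarith [ht.2])))
  have hφc : HasCompactSupport φ := by
    apply HasCompactSupport.intro (isCompact_Icc (a := -R) (b := R))
    intro x hx
    apply hφ0
    by_contra hlt
    rw [not_le, abs_lt] at hlt
    exact hx ⟨hlt.1.le, hlt.2.le⟩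
  have key := h φ hφs hφc
  rw [hφd'] at key
  have hψf : Integrable (fun x => ψ x * f x) := by
    simpa using hf.integrable_smul_left_of_hasCompactSupport hψs.continuous hψc
  have hηf : Integrable (fun x => η x * f x) := by
    simpa using hf.integrable_smul_left_of_hasCompactSupport hηs.continuous hηc
  have : ∫ x, k x * f x = (∫ x, ψ x * f x) - m * ∫ x, η x * f x := by
    rw [← integral_const_mul, ← integral_sub hψf (hηf.const_mul m)]
    congr 1; ext x; simp only [k]; ring
  simp only [smul_eq_mul]
  rw [integral_mul_const]
  linarith

theorem eq_primitive_of_weakDeriv {u v : ℝ → ℝ} (hu : LocallyIntegrable u)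
    (hv : LocallyIntegrable v)
    (h : ∀ φ : ℝ → ℝ, ContDiff ℝ ∞ φ → HasCompactSupport φ →
      ∫ x, deriv φ x * u x = -∫ x, φ x * v x) :
    ∃ c : ℝ, ∀ᵐ x, u x = c + ∫ t in (0:ℝ)..x, v t := by
  have hVc : Continuous (fun x => ∫ t in (0:ℝ)..x, v t) :=
    intervalIntegral.continuous_primitive (locInt_intervalIntegrable hv) 0
  obtain ⟨c, hc⟩ := const_of_weakDeriv_zero (hu.sub hVc.locallyIntegrable) (by
    intro φ hφ hφc
    obtain ⟨R, hR, h0⟩ := exists_support_radius hφc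
    obtain ⟨R', hR', h0'⟩ := exists_support_radius hφc.deriv
    set S := max R R'
    have hS : 0 ≤ S := le_max_of_le_left hR
    have hdφ : Continuous (deriv φ) := hφ.continuous_deriv (by simp)
    have i1 : Integrable (fun x => deriv φ x * u x) := by
      simpa using hu.integrable_smul_left_of_hasCompactSupport hdφ hφc.deriv
    have i2 : Integrable (fun x => deriv φ x * ∫ t in (0:ℝ)..x, v t) := by
      simpa using hVc.locallyIntegrable.integrable_smul_left_of_hasCompactSupport hdφ hφc.deriv
    have e := ibp_primitive hv (hφ.of_le (by simp)) 0 S hS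
      (h0 _ (by rw [abs_neg, abs_of_nonneg hS]; exact le_max_left _ _))
      (h0 _ (by rw [abs_of_nonneg hS]; exact le_max_left _ _))
    simp only [zero_add] at e
    rw [← integral_eq_of_support hS, ← integral_eq_of_support hS] at e
    · simp only [Pi.sub_apply, mul_sub]
      rw [integral_sub i1 i2, h φ hφ hφc, e]; ring
    · intro x hx; rw [h0 x ((le_max_left _ _).trans hx), zero_mul]
    · intro x hx; rw [h0' x ((le_max_right _ _).trans hx), zero_mul])
  refine ⟨c, ?_⟩
  filter_upwards [hc] with x hx
  simp only [Pi.sub_apply] at hx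
  linarith


theorem memLp_mul_deriv_real {u v w : ℝ → ℝ} (hu : MemLp u 2) (hv : MemLp v 2) (hw : MemLp w 2)
    (hx : MemLp (fun x => x ^ 2 * u x) 2)
    (huv : ∀ φ : ℝ → ℝ, ContDiff ℝ ∞ φ → HasCompactSupport φ →
      ∫ x, deriv φ x * u x = -∫ x, φ x * v x)
    (hvw : ∀ φ : ℝ → ℝ, ContDiff ℝ ∞ φ → HasCompactSupport φ →
      ∫ x, deriv φ x * v x = -∫ x, φ x * w x) :
    MemLp (fun x => x * v x) 2 := by
  have lu : LocallyIntegrable u := hu.locallyIntegrable (by norm_num)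
  have lv : LocallyIntegrable v := hv.locallyIntegrable (by norm_num)
  have lw : LocallyIntegrable w := hw.locallyIntegrable (by norm_num)
  obtain ⟨c', hG⟩ := eq_primitive_of_weakDeriv lv lw hvw
  obtain ⟨c, hF0⟩ := eq_primitive_of_weakDeriv lu lv huv
  set G : ℝ → ℝ := fun x => c' + ∫ t in (0:ℝ)..x, w t with hGdef
  have hGc : Continuous G :=
    continuous_const.add (intervalIntegral.continuous_primitive (locInt_intervalIntegrable lw) 0)
  set F : ℝ → ℝ := fun x => c + ∫ t in (0:ℝ)..x, G t with hFdef
  have hF : u =ᵐ[volume] F := by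
    filter_upwards [hF0] with x hx
    rw [hx]
    simp only [hFdef]
    congr 1
    apply intervalIntegral.integral_congr_ae
    filter_upwards [hG] with t ht _ using ht
  have hFd : ∀ x, HasDerivAt F (G x) x := fun x =>
    ((hGc.integral_hasStrictDerivAt 0 x).hasDerivAt).const_add c
  have hFs : ContDiff ℝ 1 F := by
    rw [contDiff_one_iff_deriv]
    refine ⟨fun x => (hFd x).differentiableAt, ?_⟩
    rw [funext fun x => (hFd x).deriv]
    exact hGc
  have hFc := hFs.continuous
  have mF : MemLp F 2 := hu.ae_eq hF
  have mxF : MemLp (fun x => x ^ 2 * F x) 2 := hx.ae_eq (by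
    filter_upwards [hF] with x hx
    rw [hx])
  have iF : Integrable (fun x => F x ^ 2) := mF.integrable_sq
  have ixF : Integrable (fun x => (x ^ 2 * F x) ^ 2) := mxF.integrable_sq
  have iw : Integrable (fun x => w x ^ 2) := hw.integrable_sq
  let M : ℝ → ℝ := fun x => 36 * F x ^ 2 + w x ^ 2 + (x ^ 2 * F x) ^ 2
  have iM : Integrable M := ((iF.const_mul 36).add iw).add ixF
  have hM0 : ∀ x, 0 ≤ M x := fun x => by positivity
  have key : ∀ R : ℝ, 1 ≤ R →
      ∫ x in (-(R / 2))..(R / 2), ‖(x * G x) ^ 2‖ ≤ 2 * ∫ x, M x := by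
    intro R hR
    have hR0 : 0 < R := by linarith
    let s : ℝ → ℝ := fun x => x * (1 - x ^ 2 / R ^ 2)
    let s' : ℝ → ℝ := fun x => 1 - 3 * x ^ 2 / R ^ 2
    have hsd : ∀ x, HasDerivAt s (s' x) x := fun x => by
      have := (hasDerivAt_id x).mul (((hasDerivAt_id x).pow 2).div_const (R ^ 2) |>.const_sub 1)
      convert! this using 1
      simp [s']
      field_simp
      ring
    have hss : ContDiff ℝ 1 s := by
      apply contDiff_id.mul
      exact contDiff_const.sub ((contDiff_id.pow 2).div_const _)
    have hsc := hss.continuous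
    have hs'c : Continuous s' := by fun_prop
    let P : ℝ → ℝ := fun x => s x ^ 2 * F x
    have hPs : ContDiff ℝ 1 P := (hss.pow 2).mul hFs
    have hPd : ∀ x, deriv P x = 2 * s x * s' x * F x + s x ^ 2 * G x := fun x => by
      have := ((hsd x).pow 2).mul (hFd x)
      have h2 : deriv P x = _ := this.deriv
      rw [h2]; simp
    have hsR : s R = 0 := by simp [s, hR0.ne']
    have hsR' : s (-R) = 0 := by simp [s, hR0.ne']
    have e := ibp_primitive lw hPs c' R hR0.le (by simp [P, hsR']) (by simp [P, hsR])
    have ii : ∀ {f : ℝ → ℝ}, Continuous f → ∀ a b, IntervalIntegrable f volume a b :=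
      fun hf a b => hf.intervalIntegrable a b
    have hcA : Continuous (fun x => (s x * G x) ^ 2) := by fun_prop
    have hcB : Continuous (fun x => 2 * s x * s' x * F x * G x) := by fun_prop
    have hPw : IntervalIntegrable (fun x => P x * w x) volume (-R) R :=
      (locInt_intervalIntegrable lw (-R) R).continuousOn_mul hPs.continuous.continuousOn
    have e2 : ∫ x in (-R)..R, deriv P x * (c' + ∫ t in (0:ℝ)..x, w t)
        = (∫ x in (-R)..R, (s x * G x) ^ 2) + ∫ x in (-R)..R, 2 * s x * s' x * F x * G x := by
      rw [← intervalIntegral.integral_add (ii hcA _ _) (ii hcB _ _)]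
      congr 1; ext x
      rw [hPd]
      simp only [hGdef]
      ring
    rw [e2] at e
    have e3 : ∫ x in (-R)..R, (s x * G x) ^ 2
        = ∫ x in (-R)..R, (-(2 * s x * s' x * F x * G x) - P x * w x) := by
      have := intervalIntegral.integral_sub (ii hcB (-R) R).neg hPw
      simp only [Pi.neg_apply] at this
      rw [this, intervalIntegral.integral_neg]
      linarith
    have hs1 : ∀ x ∈ Icc (-R) R, 0 ≤ 1 - x ^ 2 / R ^ 2 ∧ x ^ 2 / R ^ 2 ≤ 1 := fun x hx => by
      have : x ^ 2 / R ^ 2 ≤ 1 := by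
        rw [div_le_one (by positivity)]
        exact sq_le_sq' hx.1 hx.2
      exact ⟨by linarith, this⟩
    have b1 : ∫ x in (-R)..R, (-(2 * s x * s' x * F x * G x) - P x * w x)
        ≤ ∫ x in (-R)..R, ((1 / 2) * (s x * G x) ^ 2 + (1 / 2) * M x) := by
      apply intervalIntegral.integral_mono_on (by linarith) ((ii hcB _ _).neg.sub hPw)
        (((ii hcA _ _).const_mul _).add (iM.intervalIntegrable.const_mul _))
      intro x hx
      obtain ⟨h0, h1⟩ := hs1 x hx
      have hs'2 : s' x ^ 2 ≤ 9 := by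
        have h3 : 0 ≤ x ^ 2 / R ^ 2 := by positivity
        have : s' x = 1 - 3 * (x ^ 2 / R ^ 2) := by simp only [s']; ring
        rw [this]; nlinarith
      have hs2 : s x ^ 2 ≤ x ^ 2 := by
        have h3 : 0 ≤ x ^ 2 / R ^ 2 := by positivity
        simp only [s]
        rw [mul_pow]
        have : (1 - x ^ 2 / R ^ 2) ^ 2 ≤ 1 := by nlinarith
        nlinarith [sq_nonneg x]
      have t1 : -(2 * s x * s' x * F x * G x) ≤ 1 / 2 * (s x * G x) ^ 2 + 2 * (s' x ^ 2 * F x ^ 2) := by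
        nlinarith [sq_nonneg (s x * G x + 2 * s' x * F x)]
      have t2 : s' x ^ 2 * F x ^ 2 ≤ 9 * F x ^ 2 :=
        mul_le_mul_of_nonneg_right hs'2 (sq_nonneg _)
      have t3 : -(P x * w x) ≤ 1 / 2 * (s x ^ 2 * F x) ^ 2 + 1 / 2 * w x ^ 2 := by
        simp only [P]
        nlinarith [sq_nonneg (s x ^ 2 * F x + w x)]
      have t4 : (s x ^ 2 * F x) ^ 2 ≤ (x ^ 2 * F x) ^ 2 := by
        rw [mul_pow (s x ^ 2), mul_pow (x ^ 2)]
        exact mul_le_mul_of_nonneg_right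
          (pow_le_pow_left₀ (sq_nonneg _) hs2 2) (sq_nonneg _)
      simp only [M, Pi.neg_apply]
      linarith
    rw [← e3, intervalIntegral.integral_add ((ii hcA _ _).const_mul _)
      (iM.intervalIntegrable.const_mul _), intervalIntegral.integral_const_mul,
      intervalIntegral.integral_const_mul] at b1
    have b2 : ∫ x in (-R)..R, M x ≤ ∫ x, M x := by
      rw [intervalIntegral.integral_of_le (by linarith)]
      exact setIntegral_le_integral iM (Eventually.of_forall hM0)
    have b3 : ∫ x in (-(R / 2))..(R / 2), (s x * G x) ^ 2 ≤ ∫ x in (-R)..R, (s x * G x) ^ 2 :=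
      intervalIntegral.integral_mono_interval (by linarith) (by linarith) (by linarith)
        (Eventually.of_forall fun x => sq_nonneg _) (ii hcA _ _)
    have b4 : ∫ x in (-(R / 2))..(R / 2), ‖(x * G x) ^ 2‖
        ≤ ∫ x in (-(R / 2))..(R / 2), 2 * (s x * G x) ^ 2 := by
      apply intervalIntegral.integral_mono_on (by linarith) (ii (by fun_prop) _ _)
        (ii (by fun_prop) _ _)
      intro x hx
      have h1 : x ^ 2 / R ^ 2 ≤ 1 / 4 := by
        rw [div_le_iff₀ (by positivity)]
        nlinarith [hx.1, hx.2]
      have h2 : 1 ≤ 2 * (1 - x ^ 2 / R ^ 2) ^ 2 := by nlinarith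
      rw [Real.norm_of_nonneg (sq_nonneg _)]
      have h3 : (s x * G x) ^ 2 = (1 - x ^ 2 / R ^ 2) ^ 2 * (x * G x) ^ 2 := by
        simp only [s]; ring
      rw [h3]
      nlinarith [sq_nonneg (x * G x)]
    rw [intervalIntegral.integral_const_mul] at b4
    linarith
  have iG : Integrable (fun x => (x * G x) ^ 2) := by
    have hc : Continuous (fun x => (x * G x) ^ 2) := by fun_prop
    refine integrable_of_intervalIntegral_norm_bounded (l := atTop) (a := fun R : ℝ => -(R / 2))
      (b := fun R : ℝ => R / 2) (2 * ∫ x, M x) (fun R => ?_) ?_ ?_ ?_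
    · exact (hc.locallyIntegrable.integrableOn_isCompact isCompact_Icc).mono_set Ioc_subset_Icc_self
    · exact tendsto_neg_atTop_atBot.comp (tendsto_id.atTop_div_const (by norm_num))
    · exact tendsto_id.atTop_div_const (by norm_num)
    · filter_upwards [eventually_ge_atTop (1:ℝ)] with R hR using key R hR
  have mG : MemLp (fun x => x * G x) 2 := by
    rw [memLp_two_iff_integrable_sq (by fun_prop)]
    exact iG
  refine mG.ae_eq ?_
  filter_upwards [hG] with x hx
  rw [hx]

/-- `g` is the weak derivative of `f` on the real line. The test functions are the smooth compactly
supported real functions (complex test functions give the same notion, by linearity). -/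
structure HasWeakDeriv (f g : ℝ → ℂ) : Prop where
  locallyIntegrable_left : LocallyIntegrable f
  locallyIntegrable_right : LocallyIntegrable g
  integral_eq : ∀ φ : ℝ → ℝ, ContDiff ℝ ∞ φ → HasCompactSupport φ →
    ∫ x, deriv φ x • f x = -∫ x, φ x • g x

theorem HasWeakDeriv.integrable_left {f g : ℝ → ℂ} (h : HasWeakDeriv f g) {φ : ℝ → ℝ}
    (hφ : ContDiff ℝ ∞ φ) (hc : HasCompactSupport φ) : Integrable fun x => deriv φ x • f x :=
  h.locallyIntegrable_left.integrable_smul_left_of_hasCompactSupport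
    (hφ.continuous_deriv (by simp)) hc.deriv

theorem HasWeakDeriv.integrable_right {f g : ℝ → ℂ} (h : HasWeakDeriv f g) {φ : ℝ → ℝ}
    (hφ : ContDiff ℝ ∞ φ) (hc : HasCompactSupport φ) : Integrable fun x => φ x • g x :=
  h.locallyIntegrable_right.integrable_smul_left_of_hasCompactSupport hφ.continuous hc

theorem HasWeakDeriv.congr {f g f' g' : ℝ → ℂ} (h : HasWeakDeriv f g) (hf : f =ᵐ[volume] f')
    (hg : g =ᵐ[volume] g') : HasWeakDeriv f' g' where
  locallyIntegrable_left := h.locallyIntegrable_left.congr hf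
  locallyIntegrable_right := h.locallyIntegrable_right.congr hg
  integral_eq φ hφ hc := by
    have e1 : ∫ x, deriv φ x • f' x = ∫ x, deriv φ x • f x :=
      integral_congr_ae (by filter_upwards [hf] with x hx; rw [hx])
    have e2 : ∫ x, φ x • g' x = ∫ x, φ x • g x :=
      integral_congr_ae (by filter_upwards [hg] with x hx; rw [hx])
    rw [e1, e2, h.integral_eq φ hφ hc]

theorem HasWeakDeriv.add {f g f' g' : ℝ → ℂ} (h : HasWeakDeriv f g) (h' : HasWeakDeriv f' g') :
    HasWeakDeriv (f + f') (g + g') where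
  locallyIntegrable_left := h.locallyIntegrable_left.add h'.locallyIntegrable_left
  locallyIntegrable_right := h.locallyIntegrable_right.add h'.locallyIntegrable_right
  integral_eq φ hφ hc := by
    simp only [Pi.add_apply, smul_add]
    rw [integral_add (h.integrable_left hφ hc) (h'.integrable_left hφ hc),
      integral_add (h.integrable_right hφ hc) (h'.integrable_right hφ hc),
      h.integral_eq φ hφ hc, h'.integral_eq φ hφ hc]
    ring

theorem HasWeakDeriv.const_smul {f g : ℝ → ℂ} (h : HasWeakDeriv f g) (c : ℂ) :
    HasWeakDeriv (c • f) (c • g) where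
  locallyIntegrable_left := h.locallyIntegrable_left.smul c
  locallyIntegrable_right := h.locallyIntegrable_right.smul c
  integral_eq φ hφ hc := by
    simp only [Pi.smul_apply, smul_comm _ c]
    rw [integral_smul, integral_smul, h.integral_eq φ hφ hc, smul_neg]

theorem HasWeakDeriv.unique {f g g' : ℝ → ℂ} (h : HasWeakDeriv f g) (h' : HasWeakDeriv f g') :
    g =ᵐ[volume] g' := by
  apply ae_eq_of_integral_contDiff_smul_eq h.locallyIntegrable_right h'.locallyIntegrable_right
  intro φ hφ hc
  have := h.integral_eq φ hφ hc
  rw [h'.integral_eq φ hφ hc] at this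
  exact (neg_injective this).symm

theorem HasWeakDeriv.re {f g : ℝ → ℂ} (h : HasWeakDeriv f g) {φ : ℝ → ℝ}
    (hφ : ContDiff ℝ ∞ φ) (hc : HasCompactSupport φ) :
    ∫ x, deriv φ x * (f x).re = -∫ x, φ x * (g x).re := by
  have e1 := integral_re (h.integrable_left hφ hc)
  have e2 := integral_re (h.integrable_right hφ hc)
  rw [h.integral_eq φ hφ hc, map_neg, ← e2] at e1
  simpa using e1

theorem HasWeakDeriv.im {f g : ℝ → ℂ} (h : HasWeakDeriv f g) {φ : ℝ → ℝ}
    (hφ : ContDiff ℝ ∞ φ) (hc : HasCompactSupport φ) :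
    ∫ x, deriv φ x * (f x).im = -∫ x, φ x * (g x).im := by
  have e1 := integral_im (h.integrable_left hφ hc)
  have e2 := integral_im (h.integrable_right hφ hc)
  rw [h.integral_eq φ hφ hc, map_neg, ← e2] at e1
  simpa using e1

theorem memLp_mul_deriv {u v w : ℝ → ℂ} (hu : MemLp u 2) (hv : MemLp v 2) (hw : MemLp w 2)
    (hx : MemLp (fun x : ℝ => (x : ℂ) ^ 2 * u x) 2) (huv : HasWeakDeriv u v)
    (hvw : HasWeakDeriv v w) : MemLp (fun x : ℝ => (x : ℂ) * v x) 2 := by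
  have h1 := memLp_mul_deriv_real hu.re hv.re hw.re
    (hx.re.ae_eq (Eventually.of_forall fun x => by
      simp only [← Complex.ofReal_pow, RCLike.re_to_complex, Complex.re_ofReal_mul]))
    (fun φ hφ hc => huv.re hφ hc) (fun φ hφ hc => hvw.re hφ hc)
  have h2 := memLp_mul_deriv_real hu.im hv.im hw.im
    (hx.im.ae_eq (Eventually.of_forall fun x => by
      simp only [← Complex.ofReal_pow, RCLike.im_to_complex, Complex.im_ofReal_mul]))
    (fun φ hφ hc => huv.im hφ hc) (fun φ hφ hc => hvw.im hφ hc)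
  refine (h1.ofReal (K := ℂ)).add ((h2.ofReal (K := ℂ)).const_mul Complex.I) |>.ae_eq ?_
  refine Eventually.of_forall fun x => ?_
  apply Complex.ext <;> simp

/-- The Hilbert space of (classes of) square integrable complex functions on the line. -/
abbrev L2 : Type := Lp ℂ 2 (volume : Measure ℝ)

/-- The domain: the square integrable `ψ` with weak first and second derivatives in `L²` and
`x² ψ` in `L²`. -/
def domain : Submodule ℂ L2 where
  carrier := {ψ | (∃ ψ' ψ'' : L2, HasWeakDeriv ψ ψ' ∧ HasWeakDeriv ψ' ψ'') ∧
    MemLp (fun x : ℝ => (x : ℂ) ^ 2 * ψ x) 2}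
  add_mem' := by
    rintro f g ⟨⟨f1, f2, hf1, hf2⟩, hf⟩ ⟨⟨g1, g2, hg1, hg2⟩, hg⟩
    refine ⟨⟨f1 + g1, f2 + g2,
      (hf1.add hg1).congr (Lp.coeFn_add f g).symm (Lp.coeFn_add f1 g1).symm,
      (hf2.add hg2).congr (Lp.coeFn_add f1 g1).symm (Lp.coeFn_add f2 g2).symm⟩, ?_⟩
    refine (hf.add hg).ae_eq ?_
    filter_upwards [Lp.coeFn_add f g] with x hx
    simp only [Pi.add_apply, hx, mul_add]
  zero_mem' := by
    have z : HasWeakDeriv (0 : ℝ → ℂ) 0 :=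
      ⟨locallyIntegrable_zero, locallyIntegrable_zero, by simp⟩
    have z' : HasWeakDeriv (0 : L2) (0 : L2) :=
      z.congr (Lp.coeFn_zero ℂ 2 volume).symm (Lp.coeFn_zero ℂ 2 volume).symm
    refine ⟨⟨0, 0, z', z'⟩, ?_⟩
    refine (MemLp.zero (ε := ℂ)).ae_eq ?_
    filter_upwards [Lp.coeFn_zero ℂ 2 (volume : Measure ℝ)] with x hx
    simp only [hx, Pi.zero_apply, mul_zero]
  smul_mem' := by
    rintro c f ⟨⟨f1, f2, hf1, hf2⟩, hf⟩
    refine ⟨⟨c • f1, c • f2,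
      (hf1.const_smul c).congr (Lp.coeFn_smul c f).symm (Lp.coeFn_smul c f1).symm,
      (hf2.const_smul c).congr (Lp.coeFn_smul c f1).symm (Lp.coeFn_smul c f2).symm⟩, ?_⟩
    refine (hf.const_smul c).ae_eq ?_
    filter_upwards [Lp.coeFn_smul c f] with x hx
    simp only [Pi.smul_apply, hx, smul_eq_mul, mul_left_comm]

/-- The weak first derivative of an element of the domain. -/
noncomputable def weakDeriv₁ (ψ : domain) : L2 := ψ.2.1.choose

/-- The weak second derivative of an element of the domain. -/
noncomputable def weakDeriv₂ (ψ : domain) : L2 := ψ.2.1.choose_spec.choose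

theorem hasWeakDeriv₁ (ψ : domain) : HasWeakDeriv (ψ : L2) (weakDeriv₁ ψ) :=
  ψ.2.1.choose_spec.choose_spec.1

theorem hasWeakDeriv₂ (ψ : domain) : HasWeakDeriv (weakDeriv₁ ψ) (weakDeriv₂ ψ) :=
  ψ.2.1.choose_spec.choose_spec.2

theorem weakDeriv₁_add (f g : domain) : weakDeriv₁ (f + g) = weakDeriv₁ f + weakDeriv₁ g :=
  Lp.ext <| (hasWeakDeriv₁ (f + g)).unique <|
    ((hasWeakDeriv₁ f).add (hasWeakDeriv₁ g)).congr (Lp.coeFn_add (f : L2) g).symm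
      (Lp.coeFn_add _ _).symm

theorem weakDeriv₁_smul (c : ℂ) (f : domain) : weakDeriv₁ (c • f) = c • weakDeriv₁ f :=
  Lp.ext <| (hasWeakDeriv₁ (c • f)).unique <|
    ((hasWeakDeriv₁ f).const_smul c).congr (Lp.coeFn_smul c (f : L2)).symm
      (Lp.coeFn_smul _ _).symm

theorem weakDeriv₂_add (f g : domain) : weakDeriv₂ (f + g) = weakDeriv₂ f + weakDeriv₂ g :=
  Lp.ext <| (hasWeakDeriv₂ (f + g)).unique <|
    ((hasWeakDeriv₂ f).add (hasWeakDeriv₂ g)).congr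
      (by rw [weakDeriv₁_add]; exact (Lp.coeFn_add _ _).symm) (Lp.coeFn_add _ _).symm

theorem weakDeriv₂_smul (c : ℂ) (f : domain) : weakDeriv₂ (c • f) = c • weakDeriv₂ f :=
  Lp.ext <| (hasWeakDeriv₂ (c • f)).unique <|
    ((hasWeakDeriv₂ f).const_smul c).congr
      (by rw [weakDeriv₁_smul]; exact (Lp.coeFn_smul _ _).symm) (Lp.coeFn_smul _ _).symm

/-- The differential expression
`-(1/4) ψ'' + x² ψ - γ (ψ / 2 + x ψ')` of an element `ψ` of the domain. -/
noncomputable def expression (γ : ℝ) (ψ : domain) (x : ℝ) : ℂ :=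
  -(1 / 4) * weakDeriv₂ ψ x + (x : ℂ) ^ 2 * (ψ : L2) x
    - (γ : ℂ) * ((1 / 2) * (ψ : L2) x + (x : ℂ) * weakDeriv₁ ψ x)

theorem memLp_expression (γ : ℝ) (ψ : domain) : MemLp (expression γ ψ) 2 :=
  (((Lp.memLp (weakDeriv₂ ψ)).const_mul (-(1 / 4))).add ψ.2.2).sub
    ((((Lp.memLp (ψ : L2)).const_mul (1 / 2)).add
      (memLp_mul_deriv (Lp.memLp (ψ : L2)) (Lp.memLp _) (Lp.memLp _) ψ.2.2 (hasWeakDeriv₁ ψ)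
        (hasWeakDeriv₂ ψ))).const_mul (γ : ℂ))

/-- The operator `H = -(1/4) d²/dx² + x² - γ (1/2 + x d/dx)` in `L²(ℝ)`. -/
noncomputable def hamiltonian (γ : ℝ) : L2 →ₗ.[ℂ] L2 where
  domain := domain
  toFun :=
    { toFun := fun ψ => (memLp_expression γ ψ).toLp (expression γ ψ)
      map_add' := fun f g => by
        rw [← MemLp.toLp_add]
        apply MemLp.toLp_congr
        filter_upwards [Lp.coeFn_add (f : L2) g, Lp.coeFn_add (weakDeriv₁ f) (weakDeriv₁ g),
          Lp.coeFn_add (weakDeriv₂ f) (weakDeriv₂ g)] with x h0 h1 h2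
        simp only [expression, weakDeriv₁_add, weakDeriv₂_add, Submodule.coe_add, h0, h1, h2,
          Pi.add_apply]
        ring
      map_smul' := fun c f => by
        rw [RingHom.id_apply, ← MemLp.toLp_const_smul]
        apply MemLp.toLp_congr
        filter_upwards [Lp.coeFn_smul c (f : L2), Lp.coeFn_smul c (weakDeriv₁ f),
          Lp.coeFn_smul c (weakDeriv₂ f)] with x h0 h1 h2
        simp only [expression, weakDeriv₁_smul, weakDeriv₂_smul, Submodule.coe_smul, h0, h1, h2,
          Pi.smul_apply, smul_eq_mul]
        ring }

end Swanson

section Operators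

variable {E : Type*} [NormedAddCommGroup E] [InnerProductSpace ℂ E]

/-- The numerical range `{⟨Tψ, ψ⟩ : ψ ∈ D(T), ‖ψ‖ = 1}`. The inner product `⟨f, g⟩`, linear in
its first argument, is `inner ℂ g f` in Mathlib. -/
def LinearPMap.numericalRange (T : E →ₗ.[ℂ] E) : Set ℂ :=
  {z | ∃ ψ : T.domain, ‖(ψ : E)‖ = 1 ∧ z = inner ℂ (ψ : E) (T ψ)}

/-- `R` is the bounded, everywhere defined inverse of `T - μ : D(T) → E`. -/
structure LinearPMap.IsResolventAt (T : E →ₗ.[ℂ] E) (μ : ℂ) (R : E →L[ℂ] E) : Prop where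
  mem_domain : ∀ f : E, R f ∈ T.domain
  right_inv : ∀ f : E, T ⟨R f, mem_domain f⟩ - μ • R f = f
  left_inv : ∀ ψ : T.domain, R (T ψ - μ • (ψ : E)) = ψ

/-- `T` is m-accretive: its numerical range lies in the closed right half-plane, every `μ` with
negative real part belongs to the resolvent set, and `‖(T - μ)⁻¹‖ ≤ 1 / |Re μ|` for these `μ`. -/
structure LinearPMap.IsMAccretive (T : E →ₗ.[ℂ] E) : Prop where
  numericalRange_subset : T.numericalRange ⊆ {z : ℂ | 0 ≤ z.re}
  resolvent_bound : ∀ μ : ℂ, μ.re < 0 →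
    ∃ R : E →L[ℂ] E, T.IsResolventAt μ R ∧ ‖R‖ ≤ 1 / |μ.re|

end Operators

/-!
The proof has two halves: estimates for elements of the domain, and a uniqueness theorem for the
adjoint equation.

*Estimates.* Since `γ` is real and `1/2 + x d/dx` is skew-symmetric, pairing `H ψ` with `ψ` gives
`Re ⟨H ψ, ψ⟩ = ‖ψ'‖² / 4 + ‖x ψ‖² ≥ 0`, hence the numerical range lies in the right half-plane and
`|Re μ| ‖ψ‖ ≤ ‖(H - μ) ψ‖` for `Re μ < 0`. Pairing with `x² ψ` gives
`Re ⟨H ψ, x² ψ⟩ = ‖x ψ'‖² / 4 - ‖ψ‖² / 4 + ‖x² ψ‖² + γ ‖x ψ‖²`, so that `x² ψ`, `x ψ'`, and then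
`ψ''` through the equation, are controlled by the graph norm. Therefore `H` is closed on its domain
(`ham_closed`), and `H - μ` has closed range. These pairings are computed in
`energy_identities`; as the coefficients of `H` are real, it suffices to treat real functions.

*Density of the range.* A vector `g` orthogonal to the range of `H - μ` is, after conjugation, a
distributional solution `G` of `-(1/4) G'' + x² G + γ (G / 2 + x G') = μ G`. By a du Bois-Reymond
argument it is a classical solution. The flux `F = s' / 8 - γ x s / 2` of `s = |G|²` satisfies
`F' = |G'|² / 4 + (x² - Re μ) s ≥ |Re μ| s`. Testing against the cutoff `(1 - x² / R²)³` and letting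
`R → ∞` yields `s = 0`, using only that `s` is integrable (`ae_eq_zero_of_flux`). No decay of `G` has
to be known, because the drift term contributes `x χ' s`, which is dominated by `s`.

Thus `H - μ` is bijective from the domain onto `L²`, and the lower bound on `‖(H - μ) ψ‖` is the
resolvent estimate. The argument uses no spectral theory of the harmonic oscillator.
-/

open MeasureTheory Filter Set
open scoped ContDiff Topology

namespace Swanson

/-! ### Integration by parts on the whole line -/

/-- An integrable function whose increments are the integrals of an integrable `h` has no boundary
terms at infinity: `x ↦ F x - F (-x)` is integrable and converges to `∫ h`, which must then be
zero. -/
theorem integral_eq_zero_of_primitive {F h : ℝ → ℝ} (hF : Integrable F) (hh : Integrable h)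
    (hFh : ∀ R, 0 ≤ R → F R - F (-R) = ∫ x in (-R)..R, h x) : ∫ x, h x = 0 := by
  have hlim : Tendsto (fun R => F R - F (-R)) atTop (𝓝 (∫ x, h x)) := by
    refine (intervalIntegral_tendsto_integral hh tendsto_neg_atTop_atBot tendsto_id).congr' ?_
    filter_upwards [eventually_ge_atTop 0] with R hR using (hFh R hR).symm
  refine IntegrableAtFilter.eq_zero_of_tendsto (μ := volume)
    ((hF.sub hF.comp_neg).integrableAtFilter _) (fun s hs => ?_) hlim
  obtain ⟨b, hb⟩ := mem_atTop_sets.1 hs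
  rw [← top_le_iff, ← Real.volume_Ici (a := b)]
  exact measure_mono hb

theorem integral_mul_eq_neg_deriv_mul_primitive {P V w : ℝ → ℝ} {c : ℝ} (hP : ContDiff ℝ 1 P)
    (hw : LocallyIntegrable w) (hV : ∀ x, V x = c + ∫ t in (0:ℝ)..x, w t)
    (i : Integrable fun x => P x * V x) (iw : Integrable fun x => P x * w x)
    (id : Integrable fun x => deriv P x * V x) :
    ∫ x, P x * w x = -∫ x, deriv P x * V x := by
  have key : ∫ x, (P x * w x + deriv P x * V x) = 0 := by
    refine integral_eq_zero_of_primitive i (iw.add id) fun R hR => ?_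
    have hPac : AbsolutelyContinuousOnInterval P (-R) R :=
      hP.contDiffOn.absolutelyContinuousOnInterval
    have h1 := hPac.integral_mul_deriv_eq_deriv_mul (primitive_ac hw c R hR)
    simp only [← hV] at h1
    have h2 : ∫ x in (-R)..R, P x * deriv V x = ∫ x in (-R)..R, P x * w x := by
      apply intervalIntegral.integral_congr_ae
      filter_upwards [_root_.LocallyIntegrable.ae_hasDerivAt_integral hw] with x hx _
      rw [funext hV, ((hx 0).const_add c).deriv]
    rw [h2] at h1
    rw [intervalIntegral.integral_add iw.intervalIntegrable id.intervalIntegrable]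
    linarith
  rw [integral_add iw id] at key
  linarith

/-- A locally integrable function with two locally integrable weak derivatives has a `C¹`
representative, whose derivative is a primitive of the second weak derivative. -/
theorem exists_contDiff_representative {u v w : ℝ → ℝ} (lu : LocallyIntegrable u)
    (lv : LocallyIntegrable v) (lw : LocallyIntegrable w)
    (huv : ∀ φ : ℝ → ℝ, ContDiff ℝ ∞ φ → HasCompactSupport φ →
      ∫ x, deriv φ x * u x = -∫ x, φ x * v x)
    (hvw : ∀ φ : ℝ → ℝ, ContDiff ℝ ∞ φ → HasCompactSupport φ →
      ∫ x, deriv φ x * v x = -∫ x, φ x * w x) :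
    ∃ (U V : ℝ → ℝ) (c : ℝ), u =ᵐ[volume] U ∧ v =ᵐ[volume] V ∧ Continuous V ∧
      (∀ x, HasDerivAt U (V x) x) ∧ ∀ x, V x = c + ∫ t in (0:ℝ)..x, w t := by
  obtain ⟨c, hV⟩ := eq_primitive_of_weakDeriv lv lw hvw
  obtain ⟨d, hU⟩ := eq_primitive_of_weakDeriv lu lv huv
  have hVc : Continuous fun x => c + ∫ t in (0:ℝ)..x, w t :=
    continuous_const.add (intervalIntegral.continuous_primitive (locInt_intervalIntegrable lw) 0)
  refine ⟨fun x => d + ∫ t in (0:ℝ)..x, (c + ∫ s in (0:ℝ)..t, w s), _, c, ?_, hV, hVc,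
    fun x => ((hVc.integral_hasStrictDerivAt 0 x).hasDerivAt).const_add d, fun x => rfl⟩
  filter_upwards [hU] with x hx
  rw [hx]
  congr 1
  apply intervalIntegral.integral_congr_ae
  filter_upwards [hV] with t ht _ using ht

/-! ### Energy identities for real functions -/

section Real

variable {u v w : ℝ → ℝ}

theorem memLp_mul_of_memLp_sq_mul (hu : MemLp u 2) (hx : MemLp (fun x => x ^ 2 * u x) 2) :
    MemLp (fun x => x * u x) 2 := by
  refine (hu.norm.add hx.norm).mono
    (continuous_id.aestronglyMeasurable.mul hu.aestronglyMeasurable)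
    (Eventually.of_forall fun x => ?_)
  have h : |x| ≤ 1 + x ^ 2 := by nlinarith [sq_abs x, sq_nonneg (|x| - 1)]
  simp only [Pi.add_apply, Real.norm_eq_abs, abs_mul, abs_pow, sq_abs]
  rw [abs_of_nonneg (a := |u x| + x ^ 2 * |u x|) (by positivity)]
  nlinarith [abs_nonneg (u x)]

/-- The pairings of `u''`, `u`, `x u'` with `u` and `x² u` that enter the quadratic forms. -/
theorem integral_identities (hu : MemLp u 2) (hv : MemLp v 2) (hw : MemLp w 2)
    (hx : MemLp (fun x => x ^ 2 * u x) 2)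
    (huv : ∀ φ : ℝ → ℝ, ContDiff ℝ ∞ φ → HasCompactSupport φ →
      ∫ x, deriv φ x * u x = -∫ x, φ x * v x)
    (hvw : ∀ φ : ℝ → ℝ, ContDiff ℝ ∞ φ → HasCompactSupport φ →
      ∫ x, deriv φ x * v x = -∫ x, φ x * w x) :
    (∫ x, u x * w x = -∫ x, v x ^ 2) ∧ (∫ x, u x * (x * v x) = -(1 / 2) * ∫ x, u x ^ 2) ∧
    (∫ x, (x ^ 2 * u x) * w x = (∫ x, u x ^ 2) - ∫ x, (x * v x) ^ 2) ∧
    (∫ x, (x ^ 2 * u x) * (x * v x) = -(3 / 2) * ∫ x, (x * u x) ^ 2) := by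
  have hxv := memLp_mul_deriv_real hu hv hw hx huv hvw
  have hxu : MemLp (fun x => x * u x) 2 := memLp_mul_of_memLp_sq_mul hu hx
  obtain ⟨U, V, c, hU, hV, hVc, hUd, hVp⟩ := exists_contDiff_representative
    (hu.locallyIntegrable (by norm_num)) (hv.locallyIntegrable (by norm_num))
    (hw.locallyIntegrable (by norm_num)) huv hvw
  have lw : LocallyIntegrable w := hw.locallyIntegrable (by norm_num)
  have hU1 : ContDiff ℝ 1 U := by
    rw [contDiff_one_iff_deriv, funext fun x => (hUd x).deriv]
    exact ⟨fun x => (hUd x).differentiableAt, hVc⟩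
  replace hu : MemLp U 2 := hu.ae_eq hU
  replace hv : MemLp V 2 := hv.ae_eq hV
  replace hx : MemLp (fun x => x ^ 2 * U x) 2 :=
    hx.ae_eq (by filter_upwards [hU] with x h; rw [h])
  replace hxu : MemLp (fun x => x * U x) 2 :=
    hxu.ae_eq (by filter_upwards [hU] with x h; rw [h])
  replace hxv : MemLp (fun x => x * V x) 2 :=
    hxv.ae_eq (by filter_upwards [hV] with x h; rw [h])
  have e1 : ∫ x, u x * w x = ∫ x, U x * w x :=
    integral_congr_ae (by filter_upwards [hU] with x h; rw [h])
  have e2 : ∫ x, v x ^ 2 = ∫ x, V x ^ 2 :=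
    integral_congr_ae (by filter_upwards [hV] with x h; rw [h])
  have e3 : ∫ x, u x * (x * v x) = ∫ x, U x * (x * V x) :=
    integral_congr_ae (by filter_upwards [hU, hV] with x h h'; rw [h, h'])
  have e4 : ∫ x, u x ^ 2 = ∫ x, U x ^ 2 :=
    integral_congr_ae (by filter_upwards [hU] with x h; rw [h])
  have e5 : ∫ x, (x ^ 2 * u x) * w x = ∫ x, (x ^ 2 * U x) * w x :=
    integral_congr_ae (by filter_upwards [hU] with x h; rw [h])
  have e6 : ∫ x, (x * v x) ^ 2 = ∫ x, (x * V x) ^ 2 :=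
    integral_congr_ae (by filter_upwards [hV] with x h; rw [h])
  have e7 : ∫ x, (x ^ 2 * u x) * (x * v x) = ∫ x, (x ^ 2 * U x) * (x * V x) :=
    integral_congr_ae (by filter_upwards [hU, hV] with x h h'; rw [h, h'])
  have e8 : ∫ x, (x * u x) ^ 2 = ∫ x, (x * U x) ^ 2 :=
    integral_congr_ae (by filter_upwards [hU] with x h; rw [h])
  rw [e1, e2, e3, e4, e5, e6, e7, e8]
  have iuu : Integrable fun x => U x ^ 2 := hu.integrable_sq
  have ivv : Integrable fun x => V x ^ 2 := hv.integrable_sq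
  have ixuu : Integrable fun x => (x * U x) ^ 2 := hxu.integrable_sq
  have ixvv : Integrable fun x => (x * V x) ^ 2 := hxv.integrable_sq
  have iuv : Integrable fun x => U x * V x := hu.integrable_mul hv
  have iuw : Integrable fun x => U x * w x := hu.integrable_mul hw
  have iuxv : Integrable fun x => U x * (x * V x) := hu.integrable_mul hxv
  have ixw : Integrable fun x => (x ^ 2 * U x) * w x := hx.integrable_mul hw
  have ixv : Integrable fun x => (x ^ 2 * U x) * V x := hx.integrable_mul hv
  have ixxv : Integrable fun x => (x ^ 2 * U x) * (x * V x) := hx.integrable_mul hxv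
  have p2 : ∫ x, U x * (x * V x) = -(1 / 2) * ∫ x, U x ^ 2 := by
    have h : ∫ x, (U x ^ 2 + 2 * (U x * (x * V x))) = 0 :=
      integral_eq_zero_of_hasDerivAt_of_integrable (f := fun x => x * U x ^ 2)
        (fun x => by
          refine ((hasDerivAt_id x).mul ((hUd x).pow 2)).congr_deriv ?_
          simp; ring)
        (iuu.add (iuxv.const_mul 2))
        ((hxu.integrable_mul hu).congr (Eventually.of_forall fun x => by simp; ring))
    rw [integral_add iuu (iuxv.const_mul 2), integral_const_mul] at h
    linarith
  refine ⟨?_, p2, ?_, ?_⟩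
  · have hd : deriv U = V := funext fun x => (hUd x).deriv
    have h := integral_mul_eq_neg_deriv_mul_primitive hU1 lw hVp iuv iuw
      (by rw [hd]; simpa only [sq] using ivv)
    rw [h, hd]
    simp only [sq]
  · have hd : deriv (fun x => x ^ 2 * U x) = fun x => 2 * (x * U x) + x ^ 2 * V x :=
      funext fun x => by
        refine (((hasDerivAt_id x).pow 2).mul (hUd x)).deriv.trans ?_
        simp; ring
    have i : Integrable fun x => 2 * (U x * (x * V x)) + (x * V x) ^ 2 :=
      (iuxv.const_mul 2).add ixvv
    have e : (fun x => deriv (fun x => x ^ 2 * U x) x * V x)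
        = fun x => 2 * (U x * (x * V x)) + (x * V x) ^ 2 := by
      rw [hd]; ext x; ring
    have h := integral_mul_eq_neg_deriv_mul_primitive ((contDiff_id.pow 2).mul hU1) lw hVp
      ixv ixw (by simpa only [Pi.pow_apply, id, e] using i)
    simp only [id, e] at h
    rw [integral_add (iuxv.const_mul 2) ixvv, integral_const_mul, p2] at h
    linarith
  · have h : ∫ x, (3 * (x * U x) ^ 2 + 2 * ((x ^ 2 * U x) * (x * V x))) = 0 :=
      integral_eq_zero_of_hasDerivAt_of_integrable (f := fun x => x ^ 3 * U x ^ 2)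
        (fun x => by
          refine (((hasDerivAt_id x).pow 3).mul ((hUd x).pow 2)).congr_deriv ?_
          simp; ring)
        ((ixuu.const_mul 3).add (ixxv.const_mul 2))
        ((hx.integrable_mul hxu).congr (Eventually.of_forall fun x => by simp; ring))
    rw [integral_add (ixuu.const_mul 3) (ixxv.const_mul 2), integral_const_mul,
      integral_const_mul] at h
    linarith

/-- The real operator `-(1/4) u'' + x² u - γ (u / 2 + x u')`, as a function of `u, u', u''`. -/
noncomputable def realExpression (γ : ℝ) (u v w : ℝ → ℝ) (x : ℝ) : ℝ :=
  -(1 / 4) * w x + x ^ 2 * u x - γ * ((1 / 2) * u x + x * v x)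

theorem energy_identities (γ : ℝ) (hu : MemLp u 2) (hv : MemLp v 2) (hw : MemLp w 2)
    (hx : MemLp (fun x => x ^ 2 * u x) 2)
    (huv : ∀ φ : ℝ → ℝ, ContDiff ℝ ∞ φ → HasCompactSupport φ →
      ∫ x, deriv φ x * u x = -∫ x, φ x * v x)
    (hvw : ∀ φ : ℝ → ℝ, ContDiff ℝ ∞ φ → HasCompactSupport φ →
      ∫ x, deriv φ x * v x = -∫ x, φ x * w x) :
    (∫ x, u x * realExpression γ u v w x = (1 / 4) * (∫ x, v x ^ 2) + ∫ x, (x * u x) ^ 2) ∧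
    (∫ x, (x ^ 2 * u x) * realExpression γ u v w x =
      (1 / 4) * (∫ x, (x * v x) ^ 2) - (1 / 4) * (∫ x, u x ^ 2) + (∫ x, (x ^ 2 * u x) ^ 2)
        + γ * ∫ x, (x * u x) ^ 2) := by
  have hxv := memLp_mul_deriv_real hu hv hw hx huv hvw
  have hxu : MemLp (fun x => x * u x) 2 := memLp_mul_of_memLp_sq_mul hu hx
  obtain ⟨p1, p2, p3, p4⟩ := integral_identities hu hv hw hx huv hvw
  have iuu : Integrable fun x => u x ^ 2 := hu.integrable_sq
  have ixuu : Integrable fun x => (x * u x) ^ 2 := hxu.integrable_sq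
  have ixxuu : Integrable fun x => (x ^ 2 * u x) ^ 2 := hx.integrable_sq
  have iuw : Integrable fun x => u x * w x := hu.integrable_mul hw
  have iuxv : Integrable fun x => u x * (x * v x) := hu.integrable_mul hxv
  have ixw : Integrable fun x => (x ^ 2 * u x) * w x := hx.integrable_mul hw
  have ixxv : Integrable fun x => (x ^ 2 * u x) * (x * v x) := hx.integrable_mul hxv
  constructor
  · have e : ∀ x, u x * realExpression γ u v w x = -(1 / 4) * (u x * w x) + (x * u x) ^ 2
        - (γ / 2 * u x ^ 2 + γ * (u x * (x * v x))) := fun x => by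
      simp only [realExpression]; ring
    have i1 : Integrable fun x => -(1 / 4) * (u x * w x) + (x * u x) ^ 2 :=
      (iuw.const_mul _).add ixuu
    have i2 : Integrable fun x => γ / 2 * u x ^ 2 + γ * (u x * (x * v x)) :=
      (iuu.const_mul _).add (iuxv.const_mul _)
    simp only [e]
    rw [integral_sub i1 i2,
      integral_add (iuw.const_mul _) ixuu, integral_add (iuu.const_mul _) (iuxv.const_mul _)]
    simp only [integral_const_mul]
    rw [p1, p2]
    ring
  · have e : ∀ x, (x ^ 2 * u x) * realExpression γ u v w x = -(1 / 4) * ((x ^ 2 * u x) * w x)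
        + (x ^ 2 * u x) ^ 2
        - (γ / 2 * (x * u x) ^ 2 + γ * ((x ^ 2 * u x) * (x * v x))) := fun x => by
      simp only [realExpression]; ring
    have i1 : Integrable fun x => -(1 / 4) * ((x ^ 2 * u x) * w x) + (x ^ 2 * u x) ^ 2 :=
      (ixw.const_mul _).add ixxuu
    have i2 : Integrable fun x => γ / 2 * (x * u x) ^ 2 + γ * ((x ^ 2 * u x) * (x * v x)) :=
      (ixuu.const_mul _).add (ixxv.const_mul _)
    simp only [e]
    rw [integral_sub i1 i2,
      integral_add (ixw.const_mul _) ixxuu, integral_add (ixuu.const_mul _) (ixxv.const_mul _)]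
    simp only [integral_const_mul]
    rw [p3, p4]
    ring

/-- The two energy identities bound `u'`, `x² u` and `x u'` by `H u` and `u`. -/
theorem energy_estimates {γ : ℝ} (hγ : |γ| ≤ 1) (hu : MemLp u 2) (hv : MemLp v 2)
    (hw : MemLp w 2) (hx : MemLp (fun x => x ^ 2 * u x) 2)
    (huv : ∀ φ : ℝ → ℝ, ContDiff ℝ ∞ φ → HasCompactSupport φ →
      ∫ x, deriv φ x * u x = -∫ x, φ x * v x)
    (hvw : ∀ φ : ℝ → ℝ, ContDiff ℝ ∞ φ → HasCompactSupport φ →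
      ∫ x, deriv φ x * v x = -∫ x, φ x * w x) :
    (0 ≤ ∫ x, u x * realExpression γ u v w x) ∧
    (∫ x, v x ^ 2 ≤ 5 * ((∫ x, realExpression γ u v w x ^ 2) + ∫ x, u x ^ 2)) ∧
    (∫ x, (x ^ 2 * u x) ^ 2 ≤ 5 * ((∫ x, realExpression γ u v w x ^ 2) + ∫ x, u x ^ 2)) ∧
    (∫ x, (x * v x) ^ 2 ≤ 5 * ((∫ x, realExpression γ u v w x ^ 2) + ∫ x, u x ^ 2)) := by
  have hxv := memLp_mul_deriv_real hu hv hw hx huv hvw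
  have hxu : MemLp (fun x => x * u x) 2 := memLp_mul_of_memLp_sq_mul hu hx
  obtain ⟨E1, E2⟩ := energy_identities γ hu hv hw hx huv hvw
  have hh : MemLp (realExpression γ u v w) 2 :=
    ((hw.const_mul (-(1 / 4))).add hx).sub (((hu.const_mul (1 / 2)).add hxv).const_mul γ)
  set h := realExpression γ u v w
  have n1 : 0 ≤ ∫ x, v x ^ 2 := integral_nonneg fun x => sq_nonneg _
  have n2 : 0 ≤ ∫ x, (x * u x) ^ 2 := integral_nonneg fun x => sq_nonneg _
  have n3 : 0 ≤ ∫ x, u x ^ 2 := integral_nonneg fun x => sq_nonneg _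
  have n4 : 0 ≤ ∫ x, h x ^ 2 := integral_nonneg fun x => sq_nonneg _
  have n5 : 0 ≤ ∫ x, (x * v x) ^ 2 := integral_nonneg fun x => sq_nonneg _
  have n6 : 0 ≤ ∫ x, (x ^ 2 * u x) ^ 2 := integral_nonneg fun x => sq_nonneg _
  have b1 : ∫ x, u x * h x ≤ (1 / 2) * (∫ x, u x ^ 2) + (1 / 2) * ∫ x, h x ^ 2 := by
    rw [← integral_const_mul, ← integral_const_mul,
      ← integral_add (hu.integrable_sq.const_mul _) (hh.integrable_sq.const_mul _)]
    refine integral_mono (hu.integrable_mul hh)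
      ((hu.integrable_sq.const_mul _).add (hh.integrable_sq.const_mul _)) fun x => ?_
    nlinarith [sq_nonneg (u x - h x)]
  have b2 : ∫ x, (x ^ 2 * u x) * h x
      ≤ (1 / 4) * (∫ x, (x ^ 2 * u x) ^ 2) + ∫ x, h x ^ 2 := by
    rw [← integral_const_mul,
      ← integral_add (hx.integrable_sq.const_mul _) hh.integrable_sq]
    refine integral_mono (hx.integrable_mul hh)
      ((hx.integrable_sq.const_mul _).add hh.integrable_sq) fun x => ?_
    nlinarith [sq_nonneg (x ^ 2 * u x - 2 * h x)]
  -- the term `γ ‖x u‖²`, possibly negative, is absorbed since `x² ≤ x⁴ / 4 + 1`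
  have b3 : ∫ x, (x * u x) ^ 2
      ≤ (1 / 4) * (∫ x, (x ^ 2 * u x) ^ 2) + ∫ x, u x ^ 2 := by
    rw [← integral_const_mul,
      ← integral_add (hx.integrable_sq.const_mul _) hu.integrable_sq]
    refine integral_mono hxu.integrable_sq
      ((hx.integrable_sq.const_mul _).add hu.integrable_sq) fun x => ?_
    nlinarith [sq_nonneg (x ^ 2 * u x - 2 * u x)]
  have b4 : -∫ x, (x * u x) ^ 2 ≤ γ * ∫ x, (x * u x) ^ 2 := by
    nlinarith [(abs_le.mp hγ).1]
  refine ⟨by rw [E1]; positivity, ?_, ?_, ?_⟩ <;> linarith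

end Real

/-! ### Estimates on the domain -/

/-- The operator `H` as a linear map on its domain. -/
noncomputable def ham (γ : ℝ) : domain →ₗ[ℂ] L2 := (hamiltonian γ).toFun

theorem coeFn_ham (γ : ℝ) (ψ : domain) : ham γ ψ =ᵐ[volume] expression γ ψ :=
  MemLp.coeFn_toLp (memLp_expression γ ψ)

/-- The first weak derivative `ψ ↦ ψ'` as a linear map. -/
noncomputable def derivMap : domain →ₗ[ℂ] L2 where
  toFun := weakDeriv₁
  map_add' := weakDeriv₁_add
  map_smul' := weakDeriv₁_smul

/-- Multiplication `ψ ↦ x² ψ` as a linear map. -/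
noncomputable def sqMulMap : domain →ₗ[ℂ] L2 where
  toFun ψ := ψ.2.2.toLp _
  map_add' f g := by
    rw [← MemLp.toLp_add]
    apply MemLp.toLp_congr
    filter_upwards [Lp.coeFn_add (f : L2) g] with x h0
    simp only [Submodule.coe_add, h0, Pi.add_apply, mul_add]
  map_smul' c f := by
    rw [RingHom.id_apply, ← MemLp.toLp_const_smul]
    apply MemLp.toLp_congr
    filter_upwards [Lp.coeFn_smul c (f : L2)] with x h0
    simp only [Submodule.coe_smul, h0, Pi.smul_apply, smul_eq_mul]
    ring

theorem memLp_mul_weakDeriv₁ (ψ : domain) : MemLp (fun x : ℝ => (x : ℂ) * weakDeriv₁ ψ x) 2 :=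
  memLp_mul_deriv (Lp.memLp (ψ : L2)) (Lp.memLp _) (Lp.memLp _) ψ.2.2 (hasWeakDeriv₁ ψ)
    (hasWeakDeriv₂ ψ)

/-- The map `ψ ↦ x ψ'` as a linear map. -/
noncomputable def mulDerivMap : domain →ₗ[ℂ] L2 where
  toFun ψ := (memLp_mul_weakDeriv₁ ψ).toLp _
  map_add' f g := by
    rw [← MemLp.toLp_add]
    apply MemLp.toLp_congr
    filter_upwards [Lp.coeFn_add (weakDeriv₁ f) (weakDeriv₁ g)] with x h0
    simp only [weakDeriv₁_add, h0, Pi.add_apply, mul_add]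
  map_smul' c f := by
    rw [RingHom.id_apply, ← MemLp.toLp_const_smul]
    apply MemLp.toLp_congr
    filter_upwards [Lp.coeFn_smul c (weakDeriv₁ f)] with x h0
    simp only [weakDeriv₁_smul, h0, Pi.smul_apply, smul_eq_mul]
    ring

theorem coeFn_sqMulMap (ψ : domain) :
    sqMulMap ψ =ᵐ[volume] fun x : ℝ => (x : ℂ) ^ 2 * (ψ : L2) x :=
  MemLp.coeFn_toLp ψ.2.2

theorem coeFn_mulDerivMap (ψ : domain) :
    mulDerivMap ψ =ᵐ[volume] fun x : ℝ => (x : ℂ) * weakDeriv₁ ψ x :=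
  MemLp.coeFn_toLp (memLp_mul_weakDeriv₁ ψ)

theorem re_inner_eq_re_add_im {f g : L2} {f' g' : ℝ → ℂ} (hf : f =ᵐ[volume] f')
    (hg : g =ᵐ[volume] g') :
    (inner ℂ f g).re = (∫ x, (f' x).re * (g' x).re) + ∫ x, (f' x).im * (g' x).im := by
  have mf : MemLp f' 2 := (Lp.memLp f).ae_eq hf
  have mg : MemLp g' 2 := (Lp.memLp g).ae_eq hg
  have i1 : Integrable fun x => (f' x).re * (g' x).re := mf.re.integrable_mul mg.re
  have i2 : Integrable fun x => (f' x).im * (g' x).im := mf.im.integrable_mul mg.im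
  rw [← integral_add i1 i2, L2.inner_def]
  have := integral_re (L2.integrable_inner (𝕜 := ℂ) f g)
  simp only [RCLike.re_to_complex] at this
  rw [← this]
  refine integral_congr_ae ?_
  filter_upwards [hf, hg] with x hx hx'
  rw [hx, hx']
  simp [RCLike.inner_apply]
  ring

theorem norm_sq_eq_re_add_im {f : L2} {g : ℝ → ℂ} (h : f =ᵐ[volume] g) :
    ‖f‖ ^ 2 = (∫ x, (g x).re ^ 2) + ∫ x, (g x).im ^ 2 := by
  rw [norm_sq_eq_re_inner (𝕜 := ℂ) f]
  simpa only [sq, RCLike.re_to_complex] using re_inner_eq_re_add_im h h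

theorem re_expression (γ : ℝ) (ψ : domain) (x : ℝ) : (expression γ ψ x).re =
    realExpression γ (fun x => ((ψ : L2) x).re) (fun x => (weakDeriv₁ ψ x).re)
      (fun x => (weakDeriv₂ ψ x).re) x := by
  simp [expression, realExpression, ← Complex.ofReal_pow]

theorem im_expression (γ : ℝ) (ψ : domain) (x : ℝ) : (expression γ ψ x).im =
    realExpression γ (fun x => ((ψ : L2) x).im) (fun x => (weakDeriv₁ ψ x).im)
      (fun x => (weakDeriv₂ ψ x).im) x := by
  simp [expression, realExpression, ← Complex.ofReal_pow]

/-- Since the coefficients of `H` are real, the estimates for real functions apply to the real and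
imaginary parts separately. -/
theorem domain_estimates {γ : ℝ} (hγ : |γ| ≤ 1) (ψ : domain) :
    0 ≤ (inner ℂ (ψ : L2) (ham γ ψ)).re ∧
    ‖derivMap ψ‖ ^ 2 ≤ 5 * (‖ham γ ψ‖ ^ 2 + ‖(ψ : L2)‖ ^ 2) ∧
    ‖sqMulMap ψ‖ ^ 2 ≤ 5 * (‖ham γ ψ‖ ^ 2 + ‖(ψ : L2)‖ ^ 2) ∧
    ‖mulDerivMap ψ‖ ^ 2 ≤ 5 * (‖ham γ ψ‖ ^ 2 + ‖(ψ : L2)‖ ^ 2) := by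
  have hu := Lp.memLp (ψ : L2)
  have hv := Lp.memLp (weakDeriv₁ ψ)
  have hw := Lp.memLp (weakDeriv₂ ψ)
  obtain ⟨r1, r2, r3, r4⟩ := energy_estimates hγ hu.re hv.re hw.re
    (ψ.2.2.re.ae_eq (Eventually.of_forall fun x => by
      simp only [← Complex.ofReal_pow, RCLike.re_to_complex, Complex.re_ofReal_mul]))
    (fun φ hφ hc => (hasWeakDeriv₁ ψ).re hφ hc) (fun φ hφ hc => (hasWeakDeriv₂ ψ).re hφ hc)
  obtain ⟨i1, i2, i3, i4⟩ := energy_estimates hγ hu.im hv.im hw.im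
    (ψ.2.2.im.ae_eq (Eventually.of_forall fun x => by
      simp only [← Complex.ofReal_pow, RCLike.im_to_complex, Complex.im_ofReal_mul]))
    (fun φ hφ hc => (hasWeakDeriv₁ ψ).im hφ hc) (fun φ hφ hc => (hasWeakDeriv₂ ψ).im hφ hc)
  rw [re_inner_eq_re_add_im (EventuallyEq.refl _ _) (coeFn_ham γ ψ),
    norm_sq_eq_re_add_im (coeFn_ham γ ψ), norm_sq_eq_re_add_im (EventuallyEq.refl _ (ψ : L2)),
    norm_sq_eq_re_add_im (f := derivMap ψ) (EventuallyEq.refl _ (weakDeriv₁ ψ)),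
    norm_sq_eq_re_add_im (coeFn_sqMulMap ψ), norm_sq_eq_re_add_im (coeFn_mulDerivMap ψ)]
  simp only [re_expression, im_expression, ← Complex.ofReal_pow, Complex.re_ofReal_mul,
    Complex.im_ofReal_mul]
  simp only [RCLike.re_to_complex, RCLike.im_to_complex] at *
  refine ⟨by linarith, by linarith, by linarith, by linarith⟩

/-! ### The operator is closed -/

theorem tendsto_integral_smul {φ : ℝ → ℝ} (hφ : Continuous φ) (hc : HasCompactSupport φ)
    {f : ℕ → L2} {g : L2} (h : Tendsto f atTop (𝓝 g)) :
    Tendsto (fun n => ∫ x, φ x • f n x) atTop (𝓝 (∫ x, φ x • g x)) := by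
  have hφ2 : MemLp (fun x => (φ x : ℂ)) 2 := (hφ.memLp_of_hasCompactSupport hc).ofReal
  have e : ∀ f : L2, ∫ x, φ x • f x = inner ℂ (hφ2.toLp _) f := fun f => by
    rw [L2.inner_def]
    refine integral_congr_ae ?_
    filter_upwards [hφ2.coeFn_toLp] with x hx
    rw [hx]
    simp [RCLike.inner_apply, mul_comm]
  simp only [e]
  exact tendsto_const_nhds.inner h

theorem HasWeakDeriv.of_tendsto {f g : ℕ → L2} {f₀ g₀ : L2} (hf : Tendsto f atTop (𝓝 f₀))
    (hg : Tendsto g atTop (𝓝 g₀)) (h : ∀ n, HasWeakDeriv (f n) (g n)) : HasWeakDeriv f₀ g₀ where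
  locallyIntegrable_left := (Lp.memLp f₀).locallyIntegrable (by norm_num)
  locallyIntegrable_right := (Lp.memLp g₀).locallyIntegrable (by norm_num)
  integral_eq φ hφ hc := by
    have h1 := tendsto_integral_smul (hφ.continuous_deriv (by simp)) hc.deriv hf
    have h2 := (tendsto_integral_smul hφ.continuous hc hg).neg
    simp only [fun n => (h n).integral_eq φ hφ hc] at h1
    exact tendsto_nhds_unique h1 h2

/-- Multiplication by a continuous function is a closed operator. -/
theorem ae_eq_mul_of_tendsto {p : ℝ → ℝ} (hp : Continuous p) {f F : ℕ → L2} {f₀ F₀ : L2}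
    (hf : Tendsto f atTop (𝓝 f₀)) (hF : Tendsto F atTop (𝓝 F₀))
    (h : ∀ n, F n =ᵐ[volume] fun x => (p x : ℂ) * f n x) :
    F₀ =ᵐ[volume] fun x => (p x : ℂ) * f₀ x := by
  have hl : LocallyIntegrable fun x => (p x : ℂ) * f₀ x := by
    have := ((Lp.memLp f₀).locallyIntegrable (by norm_num)).continuous_smul hp
    simpa using this
  refine ae_eq_of_integral_contDiff_smul_eq ((Lp.memLp F₀).locallyIntegrable (by norm_num)) hl ?_
  intro φ hφ hc
  have h1 := tendsto_integral_smul hφ.continuous hc hF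
  have h2 := tendsto_integral_smul (hφ.continuous.mul hp) hc.mul_right hf
  have e : ∀ n, ∫ x, φ x • F n x = ∫ x, (φ x * p x) • f n x := fun n => by
    refine integral_congr_ae ?_
    filter_upwards [h n] with x hx
    simp [hx, mul_assoc]
  simp only [e] at h1
  refine (tendsto_nhds_unique h1 h2).trans ?_
  simp [mul_assoc]

/-- A map controlled by the graph norm of `H` sends graph-convergent sequences to convergent
ones. -/
theorem exists_tendsto_of_graph_bound {γ : ℝ} (T : domain →ₗ[ℂ] L2)
    (hT : ∀ ψ, ‖T ψ‖ ^ 2 ≤ 5 * (‖ham γ ψ‖ ^ 2 + ‖(ψ : L2)‖ ^ 2)) {ψ : ℕ → domain} {g f : L2}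
    (hg : Tendsto (fun n => (ψ n : L2)) atTop (𝓝 g))
    (hf : Tendsto (fun n => ham γ (ψ n)) atTop (𝓝 f)) :
    ∃ k : L2, Tendsto (fun n => T (ψ n)) atTop (𝓝 k) := by
  apply cauchySeq_tendsto_of_complete
  rw [Metric.cauchySeq_iff]
  intro ε hε
  obtain ⟨N, hN⟩ := Metric.cauchySeq_iff.mp hg.cauchySeq (ε / 6) (by positivity)
  obtain ⟨M, hM⟩ := Metric.cauchySeq_iff.mp hf.cauchySeq (ε / 6) (by positivity)
  refine ⟨max N M, fun m hm n hn => ?_⟩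
  have h1 := hN m ((le_max_left _ _).trans hm) n ((le_max_left _ _).trans hn)
  have h2 := hM m ((le_max_right _ _).trans hm) n ((le_max_right _ _).trans hn)
  have h3 := hT (ψ m - ψ n)
  rw [map_sub, map_sub, Submodule.coe_sub, ← dist_eq_norm, ← dist_eq_norm, ← dist_eq_norm] at h3
  have d1 := dist_nonneg (x := (ψ m : L2)) (y := ψ n)
  have d2 := dist_nonneg (x := ham γ (ψ m)) (y := ham γ (ψ n))
  refine lt_of_pow_lt_pow_left₀ 2 hε.le ?_
  nlinarith

theorem ham_eq (γ : ℝ) (ψ : domain) : ham γ ψ = (-(1 / 4) : ℂ) • weakDeriv₂ ψ + sqMulMap ψ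
    - (γ : ℂ) • ((1 / 2 : ℂ) • (ψ : L2) + mulDerivMap ψ) := by
  apply Lp.ext
  filter_upwards [coeFn_ham γ ψ, coeFn_sqMulMap ψ, coeFn_mulDerivMap ψ,
    Lp.coeFn_sub ((-(1 / 4) : ℂ) • weakDeriv₂ ψ + sqMulMap ψ)
      ((γ : ℂ) • ((1 / 2 : ℂ) • (ψ : L2) + mulDerivMap ψ)),
    Lp.coeFn_add ((-(1 / 4) : ℂ) • weakDeriv₂ ψ) (sqMulMap ψ),
    Lp.coeFn_smul (-(1 / 4) : ℂ) (weakDeriv₂ ψ),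
    Lp.coeFn_smul (γ : ℂ) ((1 / 2 : ℂ) • (ψ : L2) + mulDerivMap ψ),
    Lp.coeFn_add ((1 / 2 : ℂ) • (ψ : L2)) (mulDerivMap ψ),
    Lp.coeFn_smul (1 / 2 : ℂ) (ψ : L2)] with x h1 h2 h3 h4 h5 h6 h7 h8 h9
  rw [h1, h4, Pi.sub_apply, h5, Pi.add_apply, h6, Pi.smul_apply, h7, Pi.smul_apply, h8,
    Pi.add_apply, h9, Pi.smul_apply, h2, h3]
  rfl

/-- `H` is a closed operator. -/
theorem ham_closed {γ : ℝ} (hγ : |γ| ≤ 1) {ψ : ℕ → domain} {g f : L2}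
    (hg : Tendsto (fun n => (ψ n : L2)) atTop (𝓝 g))
    (hf : Tendsto (fun n => ham γ (ψ n)) atTop (𝓝 f)) :
    ∃ χ : domain, (χ : L2) = g ∧ ham γ χ = f := by
  obtain ⟨g₁, h1⟩ := exists_tendsto_of_graph_bound derivMap
    (fun ψ => (domain_estimates hγ ψ).2.1) hg hf
  obtain ⟨k, hk⟩ := exists_tendsto_of_graph_bound sqMulMap
    (fun ψ => (domain_estimates hγ ψ).2.2.1) hg hf
  obtain ⟨l, hl⟩ := exists_tendsto_of_graph_bound mulDerivMap
    (fun ψ => (domain_estimates hγ ψ).2.2.2) hg hf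
  -- the equation expresses the second derivatives through sequences already known to converge
  obtain ⟨g₂, h2⟩ : ∃ g₂ : L2, Tendsto (fun n => weakDeriv₂ (ψ n)) atTop (𝓝 g₂) := by
    refine ⟨_, (((hk.sub (((hg.const_smul (1 / 2 : ℂ)).add hl).const_smul (γ : ℂ))).sub
      hf).const_smul (4 : ℂ)).congr fun n => ?_⟩
    rw [ham_eq]
    module
  have w1 : HasWeakDeriv g g₁ := HasWeakDeriv.of_tendsto hg h1 fun n => hasWeakDeriv₁ (ψ n)
  have w2 : HasWeakDeriv g₁ g₂ := HasWeakDeriv.of_tendsto h1 h2 fun n => hasWeakDeriv₂ (ψ n)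
  have ek : k =ᵐ[volume] fun x : ℝ => (x : ℂ) ^ 2 * g x := by
    have := ae_eq_mul_of_tendsto (p := fun x => x ^ 2) (by fun_prop) hg hk fun n => by
      simpa using coeFn_sqMulMap (ψ n)
    simpa using this
  have el : l =ᵐ[volume] fun x : ℝ => (x : ℂ) * g₁ x :=
    ae_eq_mul_of_tendsto (p := fun x => x) (by fun_prop) h1 hl fun n => coeFn_mulDerivMap (ψ n)
  let χ : domain := ⟨g, ⟨g₁, g₂, w1, w2⟩, (Lp.memLp k).ae_eq ek⟩
  have e1 : weakDeriv₁ χ = g₁ := Lp.ext ((hasWeakDeriv₁ χ).unique w1)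
  have e2 : weakDeriv₂ χ = g₂ := by
    have h := hasWeakDeriv₂ χ
    rw [e1] at h
    exact Lp.ext (h.unique w2)
  have e3 : sqMulMap χ = k := Lp.ext ((coeFn_sqMulMap χ).trans ek.symm)
  have e4 : mulDerivMap χ = l := by
    have h := coeFn_mulDerivMap χ
    rw [e1] at h
    exact Lp.ext (h.trans el.symm)
  refine ⟨χ, rfl, tendsto_nhds_unique ?_ hf⟩
  simp only [ham_eq, e2, e3, e4]
  exact ((h2.const_smul _).add hk).sub (((hg.const_smul _).add hl).const_smul _)

/-! ### Regularity of weak solutions of the adjoint equation -/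

theorem integral_deriv_mul_primitive {v φ : ℝ → ℝ} (hv : LocallyIntegrable v)
    (hφ : ContDiff ℝ ∞ φ) (hc : HasCompactSupport φ) :
    ∫ x, deriv φ x * (∫ t in (0:ℝ)..x, v t) = -∫ x, φ x * v x := by
  have hVc : Continuous fun x => ∫ t in (0:ℝ)..x, v t :=
    intervalIntegral.continuous_primitive (locInt_intervalIntegrable hv) 0
  have hφ' : Continuous (deriv φ) := hφ.continuous_deriv (by simp)
  have h := integral_mul_eq_neg_deriv_mul_primitive (c := 0) (hφ.of_le (by simp)) hv
    (V := fun x => ∫ t in (0:ℝ)..x, v t) (fun x => (zero_add _).symm)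
    ((hφ.continuous.mul hVc).integrable_of_hasCompactSupport hc.mul_right)
    (by simpa using hv.integrable_smul_left_of_hasCompactSupport hφ.continuous hc)
    ((hφ'.mul hVc).integrable_of_hasCompactSupport hc.deriv.mul_right)
  rw [h, neg_neg]

/-- A test function of mean zero is the derivative of a test function. -/
theorem exists_deriv_eq_of_integral_eq_zero {k : ℝ → ℝ} (hks : ContDiff ℝ ∞ k)
    (hkc : HasCompactSupport k) (hk : ∫ x, k x = 0) :
    ∃ φ : ℝ → ℝ, ContDiff ℝ ∞ φ ∧ HasCompactSupport φ ∧ deriv φ = k := by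
  obtain ⟨R, hR, hk0⟩ := exists_support_radius hkc
  have hkI : ∫ x in (-R)..R, k x = 0 := by rw [← integral_eq_of_support hR hk0, hk]
  have hφd : ∀ x, HasDerivAt (fun x => ∫ t in (-R)..x, k t) (k x) x := fun x =>
    (hks.continuous.integral_hasStrictDerivAt (-R) x).hasDerivAt
  have hφd' : deriv (fun x => ∫ t in (-R)..x, k t) = k := funext fun x => (hφd x).deriv
  refine ⟨fun x => ∫ t in (-R)..x, k t, ?_, ?_, hφd'⟩
  · rw [contDiff_infty_iff_deriv, hφd']
    exact ⟨fun x => (hφd x).differentiableAt, hks⟩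
  · apply HasCompactSupport.intro (isCompact_Icc (a := -R) (b := R))
    intro x hx
    rcases not_and_or.mp hx with hx | hx
    · rw [not_le] at hx
      apply intervalIntegral.integral_zero_ae
      filter_upwards with t ht
      rw [uIoc_of_ge hx.le] at ht
      exact hk0 t (le_abs.mpr (Or.inr (by linarith [ht.2])))
    · rw [not_le] at hx
      rw [← intervalIntegral.integral_add_adjacent_intervals (b := R)
        (hks.continuous.intervalIntegrable _ _) (hks.continuous.intervalIntegrable _ _), hkI,
        zero_add]
      apply intervalIntegral.integral_zero_ae
      filter_upwards with t ht
      rw [uIoc_of_le hx.le] at ht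
      exact hk0 t (le_abs.mpr (Or.inl ht.1.le))

/-- The du Bois-Reymond lemma of second order: if the second distributional derivative of `f`
vanishes, the first is constant. -/
theorem exists_weakDeriv_const {f : ℝ → ℝ} (hf : LocallyIntegrable f)
    (h : ∀ φ : ℝ → ℝ, ContDiff ℝ ∞ φ → HasCompactSupport φ → ∫ x, deriv (deriv φ) x * f x = 0) :
    ∃ c : ℝ, ∀ φ : ℝ → ℝ, ContDiff ℝ ∞ φ → HasCompactSupport φ →
      ∫ x, deriv φ x * f x = -∫ x, φ x * c := by
  obtain ⟨η, hηc, hηs, hη1⟩ : ∃ η : ℝ → ℝ, HasCompactSupport η ∧ ContDiff ℝ ∞ η ∧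
      ∫ x, η x = 1 := by
    let B : ContDiffBump (0:ℝ) := ⟨1, 2, by norm_num, by norm_num⟩
    exact ⟨B.normed volume, B.hasCompactSupport_normed, B.contDiff_normed, B.integral_normed⟩
  refine ⟨-∫ x, deriv η x * f x, fun ψ hψs hψc => ?_⟩
  have hψi : Integrable ψ := hψs.continuous.integrable_of_hasCompactSupport hψc
  have hηi : Integrable η := hηs.continuous.integrable_of_hasCompactSupport hηc
  have hkc : HasCompactSupport fun x => ψ x - (∫ x, ψ x) * η x :=
    hψc.sub (hηc.mul_left (f := fun _ => ∫ x, ψ x))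
  obtain ⟨φ, hφs, hφc, hφ⟩ := exists_deriv_eq_of_integral_eq_zero
    (k := fun x => ψ x - (∫ x, ψ x) * η x) (hψs.sub (contDiff_const.mul hηs)) hkc (by
      rw [integral_sub hψi (hηi.const_mul _), integral_const_mul, hη1]
      simp)
  have key := h φ hφs hφc
  have hd : deriv (deriv φ) = fun x => deriv ψ x - (∫ x, ψ x) * deriv η x := by
    rw [hφ]
    ext x
    exact ((hψs.differentiable (by simp) x).hasDerivAt.sub
      ((hηs.differentiable (by simp) x).hasDerivAt.const_mul _)).deriv
  have i1 : Integrable fun x => deriv ψ x * f x := by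
    simpa using hf.integrable_smul_left_of_hasCompactSupport (hψs.continuous_deriv (by simp))
      hψc.deriv
  have i2 : Integrable fun x => deriv η x * f x := by
    simpa using hf.integrable_smul_left_of_hasCompactSupport (hηs.continuous_deriv (by simp))
      hηc.deriv
  have e : ∫ x, deriv (deriv φ) x * f x
      = (∫ x, deriv ψ x * f x) - (∫ x, ψ x) * ∫ x, deriv η x * f x := by
    rw [← integral_const_mul, ← integral_sub i1 (i2.const_mul _), hd]
    congr 1; ext x; ring
  rw [integral_mul_const]
  linarith

/-- If `g'' = k + m'` as distributions, then `g' = c + ∫ k + m` for some constant `c`. -/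
theorem exists_weakDeriv_of_weakDeriv_sq {g k m : ℝ → ℝ} (hg : LocallyIntegrable g)
    (hk : LocallyIntegrable k) (hm : LocallyIntegrable m)
    (h : ∀ φ : ℝ → ℝ, ContDiff ℝ ∞ φ → HasCompactSupport φ →
      ∫ x, deriv (deriv φ) x * g x = (∫ x, φ x * k x) - ∫ x, deriv φ x * m x) :
    ∃ c : ℝ, ∀ φ : ℝ → ℝ, ContDiff ℝ ∞ φ → HasCompactSupport φ →
      ∫ x, deriv φ x * g x = -∫ x, φ x * (c + (∫ t in (0:ℝ)..x, k t) + m x) := by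
  have hKc : Continuous fun x => ∫ t in (0:ℝ)..x, k t :=
    intervalIntegral.continuous_primitive (locInt_intervalIntegrable hk) 0
  have hN : LocallyIntegrable fun x => (∫ t in (0:ℝ)..x, k t) + m x :=
    hKc.locallyIntegrable.add hm
  set N : ℝ → ℝ := fun x => (∫ t in (0:ℝ)..x, k t) + m x
  have hMc : Continuous fun x => ∫ t in (0:ℝ)..x, N t :=
    intervalIntegral.continuous_primitive (locInt_intervalIntegrable hN) 0
  have int : ∀ {φ f : ℝ → ℝ}, ContDiff ℝ ∞ φ → HasCompactSupport φ → LocallyIntegrable f →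
      Integrable fun x => φ x * f x := fun hφ hc hf => by
    simpa using hf.integrable_smul_left_of_hasCompactSupport hφ.continuous hc
  have dsm : ∀ {φ : ℝ → ℝ}, ContDiff ℝ ∞ φ → ContDiff ℝ ∞ (deriv φ) := fun hφ =>
    (contDiff_infty_iff_deriv.mp hφ).2
  obtain ⟨c, hc⟩ := exists_weakDeriv_const (hg.sub hMc.locallyIntegrable) fun φ hφ hφc => by
    simp only [Pi.sub_apply, mul_sub]
    rw [integral_sub (int (dsm (dsm hφ)) hφc.deriv.deriv hg)
        (int (dsm (dsm hφ)) hφc.deriv.deriv hMc.locallyIntegrable), h φ hφ hφc,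
      integral_deriv_mul_primitive hN (dsm hφ) hφc.deriv]
    simp only [N, mul_add]
    rw [integral_add (int (dsm hφ) hφc.deriv hKc.locallyIntegrable)
      (int (dsm hφ) hφc.deriv hm), integral_deriv_mul_primitive hk hφ hφc]
    ring
  refine ⟨c, fun φ hφ hφc => ?_⟩
  have e := hc φ hφ hφc
  simp only [Pi.sub_apply, mul_sub] at e
  rw [integral_sub (int (dsm hφ) hφc.deriv hg)
    (int (dsm hφ) hφc.deriv hMc.locallyIntegrable), integral_deriv_mul_primitive hN hφ hφc] at e
  have e' : ∫ x, φ x * (c + (∫ t in (0:ℝ)..x, k t) + m x)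
      = (∫ x, φ x * c) + ∫ x, φ x * N x := by
    rw [← integral_add (int hφ hφc (locallyIntegrable_const c)) (int hφ hφc hN)]
    congr 1; ext x; simp only [N]; ring
  linarith

/-- `a` solves the adjoint equation `-(1/4) a'' + x² a + γ (a / 2 + x a') = f` in the sense of
distributions. -/
def IsWeakAdjointSolution (γ : ℝ) (a f : ℝ → ℝ) : Prop :=
  ∀ φ : ℝ → ℝ, ContDiff ℝ ∞ φ → HasCompactSupport φ →
    ∫ x, (realExpression γ φ (deriv φ) (deriv (deriv φ)) x * a x - φ x * f x) = 0

theorem IsWeakAdjointSolution.congr {γ : ℝ} {a f a' f' : ℝ → ℝ} (h : IsWeakAdjointSolution γ a f)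
    (ha : a =ᵐ[volume] a') (hf : f =ᵐ[volume] f') : IsWeakAdjointSolution γ a' f' := by
  intro φ hφ hc
  rw [← h φ hφ hc]
  refine integral_congr_ae ?_
  filter_upwards [ha, hf] with x h1 h2
  rw [h1, h2]

theorem LocallyIntegrable.continuous_mul {p a : ℝ → ℝ} (hp : Continuous p)
    (ha : LocallyIntegrable a) : LocallyIntegrable fun x => p x * a x := by
  simpa using ha.continuous_smul hp

theorem IsWeakAdjointSolution.exists_weakDeriv {γ : ℝ} {a f : ℝ → ℝ}
    (h : IsWeakAdjointSolution γ a f) (ha : LocallyIntegrable a) (hf : LocallyIntegrable f) :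
    ∃ c : ℝ, ∀ φ : ℝ → ℝ, ContDiff ℝ ∞ φ → HasCompactSupport φ →
      ∫ x, deriv φ x * a x = -∫ x, φ x *
        (c + (∫ t in (0:ℝ)..x, ((4 * t ^ 2 - 2 * γ) * a t - 4 * f t)) + 4 * γ * x * a x) := by
  have hk : LocallyIntegrable fun x => (4 * x ^ 2 - 2 * γ) * a x - 4 * f x :=
    (LocallyIntegrable.continuous_mul (by fun_prop) ha).sub
      (LocallyIntegrable.continuous_mul continuous_const hf)
  have hm : LocallyIntegrable fun x => 4 * γ * x * a x :=
    LocallyIntegrable.continuous_mul (by fun_prop) ha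
  refine exists_weakDeriv_of_weakDeriv_sq ha hk hm fun φ hφ hc => ?_
  have hφ' : ContDiff ℝ ∞ (deriv φ) := (contDiff_infty_iff_deriv.mp hφ).2
  have i1 : Integrable fun x => deriv (deriv φ) x * a x := by
    simpa using ha.integrable_smul_left_of_hasCompactSupport (hφ'.continuous_deriv (by simp))
      hc.deriv.deriv
  have i2 : Integrable fun x => φ x * ((4 * x ^ 2 - 2 * γ) * a x - 4 * f x) := by
    simpa using hk.integrable_smul_left_of_hasCompactSupport hφ.continuous hc
  have i3 : Integrable fun x => deriv φ x * (4 * γ * x * a x) := by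
    simpa using hm.integrable_smul_left_of_hasCompactSupport hφ'.continuous hc.deriv
  have e : ∫ x, (deriv (deriv φ) x * a x - (φ x * ((4 * x ^ 2 - 2 * γ) * a x - 4 * f x)
      - deriv φ x * (4 * γ * x * a x))) = 0 := by
    have e0 := h φ hφ hc
    have : ∀ x, deriv (deriv φ) x * a x - (φ x * ((4 * x ^ 2 - 2 * γ) * a x - 4 * f x)
        - deriv φ x * (4 * γ * x * a x)) = (-4) * (realExpression γ φ (deriv φ)
          (deriv (deriv φ)) x * a x - φ x * f x) := fun x => by
      simp only [realExpression]; ring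
    simp only [this]
    rw [integral_const_mul, e0, mul_zero]
  have i23 : Integrable fun x => φ x * ((4 * x ^ 2 - 2 * γ) * a x - 4 * f x)
      - deriv φ x * (4 * γ * x * a x) := i2.sub i3
  rw [integral_sub i1 i23, integral_sub i2 i3] at e
  linarith

theorem IsWeakAdjointSolution.exists_continuous {γ : ℝ} {a f : ℝ → ℝ}
    (h : IsWeakAdjointSolution γ a f) (ha : LocallyIntegrable a) (hf : LocallyIntegrable f) :
    ∃ A : ℝ → ℝ, Continuous A ∧ a =ᵐ[volume] A := by
  have hk : LocallyIntegrable fun x => (4 * x ^ 2 - 2 * γ) * a x - 4 * f x :=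
    (LocallyIntegrable.continuous_mul (by fun_prop) ha).sub
      (LocallyIntegrable.continuous_mul continuous_const hf)
  obtain ⟨c, hc⟩ := h.exists_weakDeriv ha hf
  have hv : LocallyIntegrable fun x =>
      c + (∫ t in (0:ℝ)..x, ((4 * t ^ 2 - 2 * γ) * a t - 4 * f t)) + 4 * γ * x * a x :=
    ((locallyIntegrable_const c).add (intervalIntegral.continuous_primitive
      (locInt_intervalIntegrable hk) 0).locallyIntegrable).add
      (LocallyIntegrable.continuous_mul (by fun_prop) ha)
  obtain ⟨d, hd⟩ := eq_primitive_of_weakDeriv ha hv hc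
  exact ⟨_, continuous_const.add
    (intervalIntegral.continuous_primitive (locInt_intervalIntegrable hv) 0), hd⟩

/-- A continuous weak solution with continuous right-hand side is a classical solution. -/
theorem IsWeakAdjointSolution.exists_hasDerivAt {γ : ℝ} {A f : ℝ → ℝ}
    (h : IsWeakAdjointSolution γ A f) (hA : Continuous A) (hf : Continuous f) :
    ∃ V : ℝ → ℝ, (∀ x, HasDerivAt A (V x) x) ∧ ∀ x, HasDerivAt V
      ((4 * x ^ 2 - 2 * γ) * A x - 4 * f x + 4 * γ * (A x + x * V x)) x := by
  obtain ⟨c, hc⟩ := h.exists_weakDeriv hA.locallyIntegrable hf.locallyIntegrable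
  have hk : Continuous fun x => (4 * x ^ 2 - 2 * γ) * A x - 4 * f x := by fun_prop
  have hv : Continuous fun x =>
      c + (∫ t in (0:ℝ)..x, ((4 * t ^ 2 - 2 * γ) * A t - 4 * f t)) + 4 * γ * x * A x :=
    (continuous_const.add (intervalIntegral.continuous_primitive
      (locInt_intervalIntegrable hk.locallyIntegrable) 0)).add (by fun_prop)
  obtain ⟨d, hd⟩ := eq_primitive_of_weakDeriv hA.locallyIntegrable hv.locallyIntegrable hc
  have hd' := (Continuous.ae_eq_iff_eq volume hA (continuous_const.add
    (intervalIntegral.continuous_primitive (locInt_intervalIntegrable hv.locallyIntegrable)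
      0))).mp hd
  have hA' : ∀ x, HasDerivAt A
      (c + (∫ t in (0:ℝ)..x, ((4 * t ^ 2 - 2 * γ) * A t - 4 * f t)) + 4 * γ * x * A x) x := by
    intro x
    have := ((hv.integral_hasStrictDerivAt 0 x).hasDerivAt).const_add d
    exact this.congr_of_eventuallyEq (Eventually.of_forall fun y => congrFun hd' y)
  refine ⟨_, hA', fun x => ?_⟩
  refine ((((hk.integral_hasStrictDerivAt 0 x).hasDerivAt).const_add c).add
    (((hasDerivAt_id x).const_mul (4 * γ)).mul (hA' x))).congr_deriv ?_
  simp only [id]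
  ring

/-! ### Square integrable solutions of the adjoint eigenvalue equation vanish -/

/-- The weight `(8 + 6 x²) / (R² + x²)` is bounded for `R ≥ 1`, tends to `0` pointwise, and
dominates the error terms of the cutoff on `[-R, R]`. -/
theorem tendsto_integral_cutoff_error {s : ℝ → ℝ} (hs : Integrable s) :
    Tendsto (fun R : ℝ => ∫ x, (8 + 6 * x ^ 2) / (R ^ 2 + x ^ 2) * s x) atTop (𝓝 0) := by
  rw [← integral_zero ℝ ℝ (μ := volume)]
  refine tendsto_integral_filter_of_dominated_convergence (fun x => 8 * |s x|) ?_ ?_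
    (hs.abs.const_mul 8) ?_
  · exact Eventually.of_forall fun R =>
      (by fun_prop : Measurable fun x : ℝ => (8 + 6 * x ^ 2) / (R ^ 2 + x ^ 2)).aestronglyMeasurable.mul
        hs.aestronglyMeasurable
  · filter_upwards [eventually_ge_atTop 1] with R hR
    refine Eventually.of_forall fun x => ?_
    rw [Real.norm_eq_abs, abs_mul]
    refine mul_le_mul_of_nonneg_right ?_ (abs_nonneg _)
    rw [abs_of_nonneg (by positivity), div_le_iff₀ (by positivity)]
    nlinarith [sq_nonneg x]
  · refine Eventually.of_forall fun x => ?_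
    have h : Tendsto (fun R : ℝ => R ^ 2 + x ^ 2) atTop atTop :=
      tendsto_atTop_add_const_right _ _ (tendsto_pow_atTop two_ne_zero)
    simpa using (h.const_div_atTop (8 + 6 * x ^ 2)).mul_const (s x)

/-- Caccioppoli-type argument: a function `F = s' / 8 - γ x s / 2` with `s ≥ 0` integrable and
`F' ≥ δ s` forces `s = 0`. With the cutoff `χ = (1 - x² / R²)³`, integrating `χ F'` by parts moves
both derivatives to `χ`, and leaves `χ'' s / 8 + γ x χ' s / 2`, whose integral tends to `0`. -/
theorem ae_eq_zero_of_flux {γ δ : ℝ} (hγ : |γ| ≤ 1) (hδ : 0 < δ) {s s' F' : ℝ → ℝ}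
    (hs : Integrable s) (hs0 : ∀ x, 0 ≤ s x) (hsd : ∀ x, HasDerivAt s (s' x) x)
    (hF : ∀ x, HasDerivAt (fun x => s' x / 8 - γ / 2 * x * s x) (F' x) x) (hF'c : Continuous F')
    (hF' : ∀ x, δ * s x ≤ F' x) : s =ᵐ[volume] 0 := by
  have hsc : Continuous s := continuous_iff_continuousAt.mpr fun x => (hsd x).continuousAt
  have key : ∀ R : ℝ, 1 ≤ R → δ * (27 / 64) * ∫ x in (-(R / 2))..(R / 2), s x
      ≤ ∫ x, (8 + 6 * x ^ 2) / (R ^ 2 + x ^ 2) * s x := by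
    intro R hR
    have hR0 : 0 < R := by linarith
    have hy : ∀ x ∈ Icc (-R) R, 0 ≤ x ^ 2 / R ^ 2 ∧ x ^ 2 / R ^ 2 ≤ 1 := fun x hx => by
      refine ⟨by positivity, ?_⟩
      rw [div_le_one (by positivity)]
      exact sq_le_sq' hx.1 hx.2
    let q : ℝ → ℝ := fun x => 1 - x ^ 2 / R ^ 2
    have hq : ∀ x, HasDerivAt q (-(2 * x / R ^ 2)) x := fun x => by
      refine ((((hasDerivAt_id x).pow 2).div_const (R ^ 2)).const_sub 1).congr_deriv ?_
      simp
    have hqc : Continuous q := by fun_prop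
    -- with `χ = q ^ 3`, this is `(χ'' / 8 + γ x χ' / 2) s`
    let E : ℝ → ℝ := fun x => ((1 / 8) * (24 * x ^ 2 / R ^ 4 * q x - 6 / R ^ 2 * q x ^ 2)
      - γ / 2 * (6 * x ^ 2 / R ^ 2 * q x ^ 2)) * s x
    have hEc : Continuous E := by fun_prop
    -- the function differentiated here is `χ F - χ' s / 8`, which vanishes at `±R`
    have hW : ∀ x, HasDerivAt (fun x => q x ^ 3 * (s' x / 8 - γ / 2 * x * s x)
        + (6 * x / R ^ 2 * q x ^ 2) * s x / 8) (q x ^ 3 * F' x - E x) x := fun x => by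
      refine (((hq x).pow 3).mul (hF x) |>.add
        ((((((hasDerivAt_id x).const_mul 6).div_const (R ^ 2)).mul ((hq x).pow 2)).mul
          (hsd x)).div_const 8)).congr_deriv ?_
      simp only [E, id, Pi.mul_apply, Pi.pow_apply]
      push_cast
      field_simp
      ring
    have hint : ∫ x in (-R)..R, (q x ^ 3 * F' x - E x) = 0 := by
      rw [intervalIntegral.integral_eq_sub_of_hasDerivAt (fun x _ => hW x)
        (Continuous.intervalIntegrable (by fun_prop) _ _)]
      have h1 : q R = 0 := by simp [q, hR0.ne']
      have h2 : q (-R) = 0 := by simp [q, hR0.ne']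
      simp [h1, h2]
    rw [intervalIntegral.integral_sub (Continuous.intervalIntegrable (by fun_prop) _ _)
      (hEc.intervalIntegrable _ _), sub_eq_zero] at hint
    -- on `[-R / 2, R / 2]` one has `q ≥ 3 / 4`, hence `χ ≥ 27 / 64`
    have b1 : δ * (27 / 64) * ∫ x in (-(R / 2))..(R / 2), s x
        ≤ ∫ x in (-(R / 2))..(R / 2), q x ^ 3 * F' x := by
      rw [← intervalIntegral.integral_const_mul]
      refine intervalIntegral.integral_mono_on (by linarith)
        (Continuous.intervalIntegrable (by fun_prop) _ _)
        (Continuous.intervalIntegrable (by fun_prop) _ _) fun x hx => ?_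
      have h1 : x ^ 2 / R ^ 2 ≤ 1 / 4 := by
        rw [div_le_iff₀ (by positivity)]
        nlinarith [hx.1, hx.2]
      have h2 : (27 / 64 : ℝ) ≤ q x ^ 3 := by
        have : (3 / 4 : ℝ) ≤ q x := by simp only [q]; linarith
        calc (27 / 64 : ℝ) = (3 / 4) ^ 3 := by norm_num
          _ ≤ q x ^ 3 := pow_le_pow_left₀ (by norm_num) this 3
      have h3 : 0 ≤ δ * s x := mul_nonneg hδ.le (hs0 x)
      calc δ * (27 / 64) * s x = 27 / 64 * (δ * s x) := by ring
        _ ≤ q x ^ 3 * F' x := mul_le_mul h2 (hF' x) h3 (by linarith)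
    have b2 : ∫ x in (-(R / 2))..(R / 2), q x ^ 3 * F' x ≤ ∫ x in (-R)..R, q x ^ 3 * F' x := by
      refine intervalIntegral.integral_mono_interval (by linarith) (by linarith) (by linarith) ?_
        (Continuous.intervalIntegrable (by fun_prop) _ _)
      refine (ae_restrict_iff' measurableSet_Ioc).mpr (Eventually.of_forall fun x hx => ?_)
      have h1 := hy x ⟨hx.1.le, hx.2⟩
      have h2 : 0 ≤ q x := by simp only [q]; linarith
      exact mul_nonneg (pow_nonneg h2 3) ((mul_nonneg hδ.le (hs0 x)).trans (hF' x))
    have iE : Integrable fun x => (8 + 6 * x ^ 2) / (R ^ 2 + x ^ 2) * s x := by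
      refine (hs.const_mul 8).mono (Continuous.aestronglyMeasurable ?_)
        (Eventually.of_forall fun x => ?_)
      · exact ((by fun_prop : Continuous fun x : ℝ => 8 + 6 * x ^ 2).div (by fun_prop)
          fun x => by positivity).mul hsc
      · have h1 : (8 + 6 * x ^ 2) / (R ^ 2 + x ^ 2) ≤ 8 := by
          rw [div_le_iff₀ (by positivity)]
          nlinarith [sq_nonneg x]
        have h2 : 0 ≤ (8 + 6 * x ^ 2) / (R ^ 2 + x ^ 2) := by positivity
        rw [Real.norm_of_nonneg (mul_nonneg h2 (hs0 x)),
          Real.norm_of_nonneg (mul_nonneg (by norm_num) (hs0 x))]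
        exact mul_le_mul_of_nonneg_right h1 (hs0 x)
    have b3 : ∫ x in (-R)..R, E x
        ≤ ∫ x in (-R)..R, (8 + 6 * x ^ 2) / (R ^ 2 + x ^ 2) * s x := by
      refine intervalIntegral.integral_mono_on (by linarith) (hEc.intervalIntegrable _ _)
        iE.intervalIntegrable fun x hx => mul_le_mul_of_nonneg_right ?_ (hs0 x)
      obtain ⟨h1, h2⟩ := hy x hx
      have hq0 : 0 ≤ q x := by simp only [q]; linarith
      have hq1 : q x ≤ 1 := by simp only [q]; linarith
      have hq2 : q x ^ 2 ≤ 1 := pow_le_one₀ hq0 hq1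
      have e1 : 24 * x ^ 2 / R ^ 4 * q x ≤ 24 / R ^ 2 := by
        have : 24 * x ^ 2 / R ^ 4 * q x = 24 / R ^ 2 * (x ^ 2 / R ^ 2 * q x) := by
          field_simp
        rw [this]
        refine mul_le_of_le_one_right (by positivity) ?_
        exact mul_le_one₀ h2 hq0 hq1
      have e2 : 0 ≤ 6 / R ^ 2 * q x ^ 2 := by positivity
      have e3 : -(γ / 2 * (6 * x ^ 2 / R ^ 2 * q x ^ 2)) ≤ 3 * (x ^ 2 / R ^ 2) := by
        have t : 0 ≤ x ^ 2 / R ^ 2 * q x ^ 2 := by positivity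
        have t' : x ^ 2 / R ^ 2 * q x ^ 2 ≤ x ^ 2 / R ^ 2 := mul_le_of_le_one_right h1 hq2
        have : -(γ / 2 * (6 * x ^ 2 / R ^ 2 * q x ^ 2)) = 3 * (-γ * (x ^ 2 / R ^ 2 * q x ^ 2)) := by
          ring
        rw [this]
        nlinarith [(abs_le.mp hγ).1]
      have e4 : 3 / R ^ 2 + 3 * (x ^ 2 / R ^ 2) ≤ (8 + 6 * x ^ 2) / (R ^ 2 + x ^ 2) := by
        have : 3 / R ^ 2 + 3 * (x ^ 2 / R ^ 2) = (3 + 3 * x ^ 2) / R ^ 2 := by ring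
        rw [this, div_le_div_iff₀ (by positivity) (by positivity)]
        have : x ^ 2 ≤ R ^ 2 := sq_le_sq' hx.1 hx.2
        nlinarith [sq_nonneg x]
      have e5 : 24 / R ^ 2 = 8 * (3 / R ^ 2) := by ring
      linarith
    have b4 : ∫ x in (-R)..R, (8 + 6 * x ^ 2) / (R ^ 2 + x ^ 2) * s x
        ≤ ∫ x, (8 + 6 * x ^ 2) / (R ^ 2 + x ^ 2) * s x := by
      rw [intervalIntegral.integral_of_le (by linarith)]
      exact setIntegral_le_integral iE (Eventually.of_forall fun x =>
        mul_nonneg (by positivity) (hs0 x))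
    linarith
  have hhalf : Tendsto (fun R : ℝ => R / 2) atTop atTop := tendsto_id.atTop_div_const (by norm_num)
  have hlim := (intervalIntegral_tendsto_integral hs (tendsto_neg_atTop_atBot.comp hhalf)
    hhalf).const_mul (δ * (27 / 64))
  have hle : δ * (27 / 64) * ∫ x, s x ≤ 0 :=
    le_of_tendsto_of_tendsto hlim (tendsto_integral_cutoff_error hs)
      (by filter_upwards [eventually_ge_atTop 1] with R hR using key R hR)
  have hzero : ∫ x, s x = 0 := by
    have : 0 ≤ ∫ x, s x := integral_nonneg hs0
    nlinarith
  exact (integral_eq_zero_iff_of_nonneg hs0 hs).mp hzero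

/-- The real and imaginary parts `a`, `b` of a square integrable weak solution of the adjoint
eigenvalue equation for the eigenvalue `p + q i` vanish when `p < 0`. -/
theorem weak_adjoint_eigenfunction_eq_zero {γ p q : ℝ} (hγ : |γ| ≤ 1) (hp : p < 0) {a b : ℝ → ℝ}
    (ha : MemLp a 2) (hb : MemLp b 2)
    (h1 : IsWeakAdjointSolution γ a fun x => p * a x - q * b x)
    (h2 : IsWeakAdjointSolution γ b fun x => p * b x + q * a x) :
    a =ᵐ[volume] 0 ∧ b =ᵐ[volume] 0 := by
  have la := ha.locallyIntegrable (by norm_num)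
  have lb := hb.locallyIntegrable (by norm_num)
  obtain ⟨A, hA, eA⟩ := h1.exists_continuous la
    ((LocallyIntegrable.continuous_mul continuous_const la).sub
      (LocallyIntegrable.continuous_mul continuous_const lb))
  obtain ⟨B, hB, eB⟩ := h2.exists_continuous lb
    ((LocallyIntegrable.continuous_mul continuous_const lb).add
      (LocallyIntegrable.continuous_mul continuous_const la))
  replace h1 : IsWeakAdjointSolution γ A fun x => p * A x - q * B x :=
    h1.congr eA (by filter_upwards [eA, eB] with x h h'; rw [h, h'])
  replace h2 : IsWeakAdjointSolution γ B fun x => p * B x + q * A x :=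
    h2.congr eB (by filter_upwards [eA, eB] with x h h'; rw [h, h'])
  obtain ⟨A', hA', hA''⟩ := h1.exists_hasDerivAt hA (by fun_prop)
  obtain ⟨B', hB', hB''⟩ := h2.exists_hasDerivAt hB (by fun_prop)
  have cA' : Continuous A' := continuous_iff_continuousAt.mpr fun x => (hA'' x).continuousAt
  have cB' : Continuous B' := continuous_iff_continuousAt.mpr fun x => (hB'' x).continuousAt
  have hs : Integrable fun x => A x ^ 2 + B x ^ 2 :=
    (ha.ae_eq eA).integrable_sq.add (hb.ae_eq eB).integrable_sq
  -- the terms `± q A B` cancel in the flux of `s = A² + B²`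
  have h0 := ae_eq_zero_of_flux hγ (neg_pos.mpr hp) (s := fun x => A x ^ 2 + B x ^ 2)
    (s' := fun x => 2 * (A x * A' x + B x * B' x))
    (F' := fun x => (1 / 4) * (A' x ^ 2 + B' x ^ 2) + (x ^ 2 - p) * (A x ^ 2 + B x ^ 2))
    hs (fun x => by positivity)
    (fun x => by
      refine (((hA' x).pow 2).add ((hB' x).pow 2)).congr_deriv ?_
      simp; ring)
    (fun x => by
      refine ((((((hA' x).mul (hA'' x)).add ((hB' x).mul (hB'' x))).const_mul 2).div_const 8).sub
        (((hasDerivAt_id x).const_mul (γ / 2)).mul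
          (((hA' x).pow 2).add ((hB' x).pow 2)))).congr_deriv ?_
      simp; ring)
    (by fun_prop)
    (fun x => by
      have : 0 ≤ x ^ 2 * (A x ^ 2 + B x ^ 2) := by positivity
      nlinarith [sq_nonneg (A' x), sq_nonneg (B' x)])
  constructor
  · filter_upwards [h0, eA] with x hx hx'
    simp only [Pi.zero_apply] at hx
    rw [hx', Pi.zero_apply, ← sq_eq_zero_iff]
    linarith [sq_nonneg (A x), sq_nonneg (B x)]
  · filter_upwards [h0, eB] with x hx hx'
    simp only [Pi.zero_apply] at hx
    rw [hx', Pi.zero_apply, ← sq_eq_zero_iff]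
    linarith [sq_nonneg (A x), sq_nonneg (B x)]

/-! ### Density of the range and the resolvent -/

theorem hasWeakDeriv_ofReal {φ : ℝ → ℝ} (hφ : ContDiff ℝ ∞ φ) (hc : HasCompactSupport φ) :
    HasWeakDeriv (fun x => (φ x : ℂ)) (fun x => ((deriv φ x : ℝ) : ℂ)) where
  locallyIntegrable_left := (Complex.continuous_ofReal.comp hφ.continuous).locallyIntegrable
  locallyIntegrable_right :=
    (Complex.continuous_ofReal.comp (hφ.continuous_deriv (by simp))).locallyIntegrable
  integral_eq χ hχ hχc := by
    have hφ' : Continuous (deriv φ) := hφ.continuous_deriv (by simp)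
    have hχ' : Continuous (deriv χ) := hχ.continuous_deriv (by simp)
    have h := integral_mul_deriv_eq_deriv_mul_of_integrable (u := χ) (v := φ)
      (fun x _ => (hχ.differentiable (by simp) x).hasDerivAt)
      (fun x _ => (hφ.differentiable (by simp) x).hasDerivAt)
      ((hχ.continuous.mul hφ').integrable_of_hasCompactSupport hχc.mul_right)
      ((hχ'.mul hφ.continuous).integrable_of_hasCompactSupport hc.mul_left)
      ((hχ.continuous.mul hφ.continuous).integrable_of_hasCompactSupport hχc.mul_right)
    simp only [Complex.real_smul, ← Complex.ofReal_mul]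
    rw [integral_complex_ofReal, integral_complex_ofReal, h]
    simp

/-- Test functions belong to the domain, and `H` acts on them classically. -/
theorem exists_domain_of_test (γ : ℝ) {φ : ℝ → ℝ} (hφ : ContDiff ℝ ∞ φ)
    (hc : HasCompactSupport φ) : ∃ ψ : domain, (ψ : L2) =ᵐ[volume] (fun x => (φ x : ℂ)) ∧
      ham γ ψ =ᵐ[volume]
        fun x => ((realExpression γ φ (deriv φ) (deriv (deriv φ)) x : ℝ) : ℂ) := by
  have hφ' : ContDiff ℝ ∞ (deriv φ) := (contDiff_infty_iff_deriv.mp hφ).2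
  have hφ'' : ContDiff ℝ ∞ (deriv (deriv φ)) := (contDiff_infty_iff_deriv.mp hφ').2
  have m : ∀ {χ : ℝ → ℝ}, ContDiff ℝ ∞ χ → HasCompactSupport χ →
      MemLp (fun x => (χ x : ℂ)) 2 := fun hχ hχc =>
    (hχ.continuous.memLp_of_hasCompactSupport hχc).ofReal
  have m0 := m hφ hc
  have m1 := m hφ' hc.deriv
  have m2 := m hφ'' hc.deriv.deriv
  have w1 : HasWeakDeriv (m0.toLp _) (m1.toLp _) :=
    (hasWeakDeriv_ofReal hφ hc).congr m0.coeFn_toLp.symm m1.coeFn_toLp.symm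
  have w2 : HasWeakDeriv (m1.toLp _) (m2.toLp _) :=
    (hasWeakDeriv_ofReal hφ' hc.deriv).congr m1.coeFn_toLp.symm m2.coeFn_toLp.symm
  have mx : MemLp (fun x : ℝ => (x : ℂ) ^ 2 * m0.toLp _ x) 2 := by
    refine (m (χ := fun x => x ^ 2 * φ x) ((contDiff_id.pow 2).mul hφ) hc.mul_left).ae_eq ?_
    filter_upwards [m0.coeFn_toLp] with x hx
    rw [hx]
    simp
  let ψ : domain := ⟨m0.toLp _, ⟨_, _, w1, w2⟩, mx⟩
  have e1 : weakDeriv₁ ψ = m1.toLp _ := Lp.ext ((hasWeakDeriv₁ ψ).unique w1)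
  have e2 : weakDeriv₂ ψ = m2.toLp _ := by
    have h := hasWeakDeriv₂ ψ
    rw [e1] at h
    exact Lp.ext (h.unique w2)
  refine ⟨ψ, m0.coeFn_toLp, ?_⟩
  filter_upwards [coeFn_ham γ ψ, m0.coeFn_toLp, m1.coeFn_toLp, m2.coeFn_toLp] with x h h0 h1 h2
  rw [h, expression, e1, e2, h1, h2]
  change _ + _ * m0.toLp _ x - _ * (_ * m0.toLp _ x + _) = _
  rw [h0]
  simp [realExpression]

/-- A vector orthogonal to the range of `H - μ` is a weak solution of the adjoint equation, hence
zero. -/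
theorem eq_zero_of_orthogonal_range {γ : ℝ} (hγ : |γ| ≤ 1) {μ : ℂ} (hμ : μ.re < 0) {g : L2}
    (hg : ∀ ψ : domain, inner ℂ g (ham γ ψ - μ • (ψ : L2)) = 0) : g = 0 := by
  have key : ∀ φ : ℝ → ℝ, ContDiff ℝ ∞ φ → HasCompactSupport φ →
      ∃ F : ℝ → ℂ, Integrable F ∧ ∫ x, F x = 0 ∧ F =ᵐ[volume] fun x =>
        ((realExpression γ φ (deriv φ) (deriv (deriv φ)) x : ℝ) - μ * (φ x : ℂ))
          * (starRingEnd ℂ) (g x) := by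
    intro φ hφ hc
    obtain ⟨ψ, h0, h1⟩ := exists_domain_of_test γ hφ hc
    refine ⟨_, L2.integrable_inner (𝕜 := ℂ) g (ham γ ψ - μ • (ψ : L2)), hg ψ, ?_⟩
    filter_upwards [h0, h1, Lp.coeFn_sub (ham γ ψ) (μ • (ψ : L2)),
      Lp.coeFn_smul μ (ψ : L2)] with x h0 h1 h2 h3
    rw [h2, Pi.sub_apply, h3, Pi.smul_apply, h0, h1, RCLike.inner_apply, smul_eq_mul]
  have mg := Lp.memLp g
  -- `inner ℂ g` conjugates `g`, so the weak solution is `a + i b = conj g`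
  obtain ⟨ha, hb⟩ := weak_adjoint_eigenfunction_eq_zero (γ := γ) (p := μ.re) (q := μ.im)
    (a := fun x => (g x).re) (b := fun x => -(g x).im) hγ hμ mg.re mg.im.neg
    (fun φ hφ hc => by
      obtain ⟨F, hF, hF0, e⟩ := key φ hφ hc
      have h := integral_re hF
      rw [hF0] at h
      refine (integral_congr_ae ?_).trans h
      filter_upwards [e] with x hx
      rw [hx]
      simp
      ring)
    (fun φ hφ hc => by
      obtain ⟨F, hF, hF0, e⟩ := key φ hφ hc
      have h := integral_im hF
      rw [hF0] at h
      refine (integral_congr_ae ?_).trans h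
      filter_upwards [e] with x hx
      rw [hx]
      simp
      ring)
  apply Lp.ext
  filter_upwards [ha, hb, Lp.coeFn_zero ℂ 2 (volume : Measure ℝ)] with x h1 h2 h3
  rw [h3]
  exact Complex.ext h1 (by simpa using h2)

/-- The lower bound that becomes the resolvent estimate. -/
theorem neg_re_mul_norm_le {γ : ℝ} (hγ : |γ| ≤ 1) (μ : ℂ) (ψ : domain) :
    -μ.re * ‖(ψ : L2)‖ ≤ ‖ham γ ψ - μ • (ψ : L2)‖ := by
  rcases (norm_nonneg (ψ : L2)).eq_or_lt with h | h
  · rw [← h, mul_zero]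
    exact norm_nonneg _
  have h1 := (domain_estimates hγ ψ).1
  have h2 : (inner ℂ (ψ : L2) (ham γ ψ - μ • (ψ : L2))).re
      = (inner ℂ (ψ : L2) (ham γ ψ)).re - μ.re * ‖(ψ : L2)‖ ^ 2 := by
    rw [inner_sub_right, inner_smul_right, inner_self_eq_norm_sq_to_K]
    simp [← Complex.ofReal_pow]
  have h3 : (inner ℂ (ψ : L2) (ham γ ψ - μ • (ψ : L2))).re
      ≤ ‖(ψ : L2)‖ * ‖ham γ ψ - μ • (ψ : L2)‖ :=
    (Complex.re_le_norm _).trans (norm_inner_le_norm _ _)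
  refine le_of_mul_le_mul_left ?_ h
  nlinarith

/-- The linear map `H - μ` on the domain. -/
noncomputable def shiftedHam (γ : ℝ) (μ : ℂ) : domain →ₗ[ℂ] L2 := ham γ - μ • domain.subtype

theorem shiftedHam_apply (γ : ℝ) (μ : ℂ) (ψ : domain) :
    shiftedHam γ μ ψ = ham γ ψ - μ • (ψ : L2) := rfl

/-- Closedness of `H` together with the lower bound on `‖(H - μ) ψ‖`. -/
theorem isClosed_range_shiftedHam {γ : ℝ} (hγ : |γ| ≤ 1) {μ : ℂ} (hμ : μ.re < 0) :
    IsClosed (LinearMap.range (shiftedHam γ μ) : Set L2) := by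
  refine IsSeqClosed.isClosed fun F f hF hf => ?_
  choose ψ hψ using hF
  obtain ⟨g, hg⟩ : ∃ g : L2, Tendsto (fun n => (ψ n : L2)) atTop (𝓝 g) := by
    apply cauchySeq_tendsto_of_complete
    rw [Metric.cauchySeq_iff]
    intro ε hε
    obtain ⟨N, hN⟩ := Metric.cauchySeq_iff.mp hf.cauchySeq (-μ.re * ε)
      (mul_pos (neg_pos.mpr hμ) hε)
    refine ⟨N, fun m hm n hn => ?_⟩
    have h1 := hN m hm n hn
    have h2 := neg_re_mul_norm_le hγ μ (ψ m - ψ n)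
    rw [← shiftedHam_apply, map_sub, hψ, hψ, Submodule.coe_sub, ← dist_eq_norm,
      ← dist_eq_norm] at h2
    exact lt_of_mul_lt_mul_left (h2.trans_lt h1) (neg_pos.mpr hμ).le
  have hh : Tendsto (fun n => ham γ (ψ n)) atTop (𝓝 (f + μ • g)) :=
    (hf.add (hg.const_smul μ)).congr fun n => by
      rw [← hψ n, shiftedHam_apply, sub_add_cancel]
  obtain ⟨χ, h1, h2⟩ := ham_closed hγ hg hh
  exact ⟨χ, by rw [shiftedHam_apply, h1, h2, add_sub_cancel_right]⟩

theorem bijective_shiftedHam {γ : ℝ} (hγ : |γ| ≤ 1) {μ : ℂ} (hμ : μ.re < 0) :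
    Function.Bijective (shiftedHam γ μ) := by
  constructor
  · rw [← LinearMap.ker_eq_bot, LinearMap.ker_eq_bot']
    intro ψ hψ
    have h := neg_re_mul_norm_le hγ μ ψ
    rw [← shiftedHam_apply, hψ, norm_zero] at h
    have h0 : ‖(ψ : L2)‖ = 0 :=
      le_antisymm (nonpos_of_mul_nonpos_right h (neg_pos.mpr hμ)) (norm_nonneg _)
    exact Subtype.ext (norm_eq_zero.mp h0)
  · rw [← LinearMap.range_eq_top,
      ← (isClosed_range_shiftedHam hγ hμ).submodule_topologicalClosure_eq,
      Submodule.topologicalClosure_eq_top_iff, Submodule.eq_bot_iff]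
    intro g hg
    refine eq_zero_of_orthogonal_range hγ hμ fun ψ => ?_
    exact (Submodule.mem_orthogonal' _ _).mp hg _ (LinearMap.mem_range_self (shiftedHam γ μ) ψ)

theorem exists_resolvent {γ : ℝ} (hγ : |γ| ≤ 1) {μ : ℂ} (hμ : μ.re < 0) :
    ∃ R : L2 →L[ℂ] L2, (hamiltonian γ).IsResolventAt μ R ∧ ‖R‖ ≤ 1 / |μ.re| := by
  let e : domain ≃ₗ[ℂ] L2 := LinearEquiv.ofBijective (shiftedHam γ μ) (bijective_shiftedHam hγ hμ)
  have he : ∀ f, ham γ (e.symm f) - μ • (e.symm f : L2) = f := fun f => e.apply_symm_apply f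
  have hb : ∀ f, ‖(domain.subtype ∘ₗ e.symm.toLinearMap) f‖ ≤ 1 / |μ.re| * ‖f‖ := fun f => by
    have h := neg_re_mul_norm_le hγ μ (e.symm f)
    rw [he] at h
    rw [abs_of_neg hμ, one_div, ← div_eq_inv_mul, le_div_iff₀ (neg_pos.mpr hμ), mul_comm]
    exact h
  refine ⟨LinearMap.mkContinuous _ _ hb, ⟨fun f => (e.symm f).2, he, fun ψ => ?_⟩,
    LinearMap.mkContinuous_norm_le _ (by positivity) _⟩
  exact congrArg Subtype.val (e.symm_apply_apply ψ)

end Swanson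

theorem theorem3p2 (γ : ℝ) (hγ₀ : γ ≠ 0) (hγ₁ : |γ| ≤ 1) :
    (Swanson.hamiltonian γ).IsMAccretive where
  numericalRange_subset := by
    rintro z ⟨ψ, -, rfl⟩
    exact (Swanson.domain_estimates hγ₁ ψ).1
  resolvent_bound _ hμ := Swanson.exists_resolvent hγ₁ hμ
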